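/- Let $\mathcal G_d=(\mathcal V,\mathcal E)$ be a simple, connected, locally finite, unoriented graph with countably infinite vertex set, and let each edge $e$ have a length $|e|\in(0,\infty)$. Let $\mathcal G$ be the associated metric graph, obtained by identifying each edge $e$ with the interval $[0,|e|]$ and gluing edges at common vertices. Let $$H^1(\mathcal G)=\Big\{f\colon\mathcal G\to\mathbb C \text{ continuous}\;:\; f_e\in H^1(e)\ \text{for all } e\in\mathcal E,\ \sum_{e}\|f_e\|_{L^2(e)}^2<\infty,\ \sum_e\|f_e'\|_{L^2(e)}^2<\infty\Big\},$$ where $H^1(e)$ is the set of absolutely continuous functions on $e$ with derivative in $L^2(e)$, and let $\|f\|_{H^1}^2=\sum_e\big(\|f_e\|^2_{L^2(e)}+\|f_e'\|^2_{L^2(e)}\big)$. Let $\operatorname{dom}(\mathbf H_0^0)$ be the set of continuous $f\colon\mathcal G\to\mathbb C$ that are non-zero on only finitely many edges, satisfy $f_e\in H^2(e)$ (that is, $f_e,f_e'\in H^1(e)$) for every edge $e$, and satisfy $\sum_{e\ni v} f_e'(v)=0$ at every vertex $v$, where $f_e'(v)$ is the derivative at $v$ along $e$ in the direction away from $v$.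 Let $H^1_0(\mathcal G)$ be the closure of $\operatorname{dom}(\mathbf H^0_0)$ in $H^1(\mathcal G)$ with respect to $\|\cdot\|_{H^1}$. A ray is a sequence $(v_n)_{n\ge 0}$ of distinct vertices with $v_n$ adjacent to $v_{n+1}$ for all $n$; it is also regarded as the union of its edges in $\mathcal G$. Two rays are equivalent if some third ray contains infinitely many vertices of both; the equivalence classes are the graph ends. A topological end of $\mathcal G$ is an equivalence class of sequences $(U_n)_{n\ge0}$ of non-empty connected open subsets of $\mathcal G$ with compact boundaries such that $U_{n+1}\subseteq U_n$ for all $n$ and $\bigcap_n\overline{U_n}=\varnothing$, where $(U_n)$ and $(U_n')$ are equivalent if for each $n$ there are $j,k$ with $U_j'\subseteq U_n$ and $U_k\subseteq U_n'$. Let $\mathfrak C(\mathcal G)$ be the set of topological ends. For $\gamma\in\mathfrak C(\mathcal G)$ there is a unique graph end $\omega_\gamma$ such that, for every sequence $(U_n)$ representing $\gamma$, each $U_n$ contains a ray from $\omega_\gamma$; for $f\in H^1(\mathcal G)$ the value $f(\gamma)$ is the limit $\lim_n f(v_n)$ along any ray $(v_n)$ in $\omega_\gamma$ (the limit exists and does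 not depend on the ray). Then $$H^1_0(\mathcal G)=\{f\in H^1(\mathcal G)\;:\; f(\gamma)=0\ \text{for all }\gamma\in\mathfrak C(\mathcal G)\}.$$ -/

import Mathlib

open Set Filter Topology MeasureTheory
open scoped ENNReal

noncomputable section

/-- A connected, locally finite, simple graph on the vertex set `V` (not oriented), together with
a positive finite length for each edge. -/
structure MetricGraph (V : Type*) where
  graph : SimpleGraph V
  connected : graph.Connected
  locallyFinite : ∀ v, (graph.neighborSet v).Finite
  length : graph.edgeSet → ℝ
  length_pos : ∀ e, 0 < length e

namespace MetricGraph

variable {V : Type*} (M : MetricGraph V)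

/-! ### The metric graph as a topological space

A dart is an edge with a choice of one of its two directions. The dart `d` parametrizes its edge by
`[0, |e|]`, the parameter being the distance from the initial vertex `d.fst`. -/

/-- The length of the edge underlying the dart `d`. -/
def len (d : M.graph.Dart) : ℝ := M.length ⟨d.edge, d.edge_mem⟩

theorem len_pos (d : M.graph.Dart) : 0 < M.len d := M.length_pos _

theorem len_symm (d : M.graph.Dart) : M.len d.symm = M.len d := by
  simp [len]

/-- The interval `[0, |e|]` attached to a dart. -/
abbrev Interval (d : M.graph.Dart) : Type := Icc (0 : ℝ) (M.len d)

/-- The initial point of the interval. -/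
def origin (d : M.graph.Dart) : M.Interval d := ⟨0, le_refl 0, (M.len_pos d).le⟩

/-- The parameter, along the opposite dart, of the point with parameter `t` along `d`. -/
def reverse (d : M.graph.Dart) (t : M.Interval d) : M.Interval d.symm :=
  ⟨M.len d - t, sub_nonneg.2 t.2.2, by rw [M.len_symm]; exact sub_le_self _ t.2.1⟩

/-- The identifications: the initial point of each dart is its initial vertex, and the two
parametrizations of an edge describe the same points. -/
inductive Glue : V ⊕ (Σ d : M.graph.Dart, M.Interval d) →
    V ⊕ (Σ d : M.graph.Dart, M.Interval d) → Prop
  | start (d : M.graph.Dart) : Glue (Sum.inr ⟨d, M.origin d⟩) (Sum.inl d.fst)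
  | flip (d : M.graph.Dart) (t : M.Interval d) :
      Glue (Sum.inr ⟨d, t⟩) (Sum.inr ⟨d.symm, M.reverse d t⟩)

/-- The points of the metric graph: vertices and edge intervals glued together. -/
def Point : Type _ := Quot M.Glue

/-- A vertex as a point of the metric graph. -/
def vertex (v : V) : M.Point := Quot.mk _ (Sum.inl v)

/-- The point at distance `t` from `d.fst` along the dart `d`. -/
def pt (d : M.graph.Dart) (t : M.Interval d) : M.Point := Quot.mk _ (Sum.inr ⟨d, t⟩)

/-- The gluing topology: the finest topology that makes all edge parametrizations continuous. -/
instance : TopologicalSpace M.Point :=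
  ⨆ d : M.graph.Dart, TopologicalSpace.coinduced (M.pt d) inferInstance

/-! ### Rays and graph ends -/

/-- A ray: a sequence of distinct vertices, consecutive ones being adjacent. -/
structure Ray where
  toFun : ℕ → V
  injective : Function.Injective toFun
  adj : ∀ n, M.graph.Adj (toFun n) (toFun (n + 1))

variable {M} in
/-- The vertices of a ray. -/
def Ray.vertices (R : M.Ray) : Set V := range R.toFun

variable {M} in
/-- The `n`-th edge of a ray, in the direction of the ray. -/
def Ray.dart (R : M.Ray) (n : ℕ) : M.graph.Dart := ⟨(R.toFun n, R.toFun (n + 1)), R.adj n⟩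

variable {M} in
/-- A ray as a subset of the metric graph: the union of its edges. -/
def Ray.carrier (R : M.Ray) : Set M.Point := ⋃ n, range (M.pt (R.dart n))

/-- Two rays are equivalent if some third ray contains infinitely many vertices of both. -/
def RayEquiv (R₁ R₂ : M.Ray) : Prop :=
  ∃ R₃ : M.Ray, (R₃.vertices ∩ R₁.vertices).Infinite ∧ (R₃.vertices ∩ R₂.vertices).Infinite

/-- Graph ends: equivalence classes of rays. -/
def GraphEnd : Type _ := Quot M.RayEquiv

variable {M} in
/-- The ray `R` belongs to the graph end `ω`. -/
def Ray.BelongsTo (R : M.Ray) (ω : M.GraphEnd) : Prop := Quot.mk M.RayEquiv R = ω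

/-! ### Topological ends -/

/-- A decreasing sequence of non-empty connected open sets with compact boundaries whose closures
have no common point. -/
structure EndSeq where
  toFun : ℕ → Set M.Point
  isOpen : ∀ n, IsOpen (toFun n)
  isConnected : ∀ n, IsConnected (toFun n)
  isCompact_frontier : ∀ n, IsCompact (frontier (toFun n))
  succ_subset : ∀ n, toFun (n + 1) ⊆ toFun n
  iInter_closure : ⋂ n, closure (toFun n) = ∅

/-- Two such sequences are equivalent if each set of either contains a set of the other. -/
instance endSetoid : Setoid M.EndSeq where
  r U U' := ∀ n, ∃ j k, U'.toFun j ⊆ U.toFun n ∧ U.toFun k ⊆ U'.toFun n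
  iseqv :=
    { refl := fun _ n => ⟨n, n, Subset.rfl, Subset.rfl⟩
      symm := fun h n => by
        obtain ⟨j, k, h₁, h₂⟩ := h n
        exact ⟨k, j, h₂, h₁⟩
      trans := fun h h' n => by
        obtain ⟨j, -, h₁, -⟩ := h n
        obtain ⟨j', -, h₂, -⟩ := h' j
        obtain ⟨-, k, -, h₃⟩ := h' n
        obtain ⟨-, k', -, h₄⟩ := h k
        exact ⟨j', k', h₂.trans h₁, h₄.trans h₃⟩ }

/-- Topological ends of the metric graph. -/
def TopEnd : Type _ := Quotient M.endSetoid

variable {M} in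
/-- The graph end `ω` is the one determined by the topological end `γ`: for every sequence
representing `γ`, each of its sets contains a ray from `ω`. -/
def TopEnd.Corresponds (γ : M.TopEnd) (ω : M.GraphEnd) : Prop :=
  ∀ U : M.EndSeq, Quotient.mk M.endSetoid U = γ →
    ∀ n, ∃ R : M.Ray, R.BelongsTo ω ∧ R.carrier ⊆ U.toFun n

/-- The function `f` has the value `c` at the end `γ`: along each ray `(vₙ)` of the graph end
determined by `γ`, the values `f(vₙ)` converge to `c`. -/
def HasEndValue (f : M.Point → ℂ) (γ : M.TopEnd) (c : ℂ) : Prop :=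
  ∃ ω : M.GraphEnd, γ.Corresponds ω ∧ ∀ R : M.Ray, R.BelongsTo ω →
    Tendsto (fun n => f (M.vertex (R.toFun n))) atTop (𝓝 c)

/-! ### Sobolev spaces -/

/-- The restriction of `f` to an edge, as a function of the parameter in `[0, |e|]` (extended by
constants outside the interval, only so that it is defined on the real line). -/
def onEdge (f : M.Point → ℂ) (d : M.graph.Dart) : ℝ → ℂ :=
  IccExtend (M.len_pos d).le fun t => f (M.pt d t)

/-- The derivative of `f` along an edge, in the direction of `d` (one-sided at the end points). -/
def derivOnEdge (f : M.Point → ℂ) (d : M.graph.Dart) : ℝ → ℂ :=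
  derivWithin (M.onEdge f d) (Icc 0 (M.len d))

end MetricGraph

/-- `H¹[0, L]`: absolutely continuous functions with square integrable derivative. -/
def MemSobolevOne (L : ℝ) (g : ℝ → ℂ) : Prop :=
  AbsolutelyContinuousOnInterval g 0 L ∧
    MemLp (derivWithin g (Icc 0 L)) 2 (volume.restrict (Icc 0 L))

/-- `H²[0, L]`: functions in `H¹[0, L]` whose derivative is in `H¹[0, L]`. -/
def MemSobolevTwo (L : ℝ) (g : ℝ → ℂ) : Prop :=
  MemSobolevOne L g ∧ DifferentiableOn ℝ g (Icc 0 L) ∧ MemSobolevOne L (derivWithin g (Icc 0 L))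

namespace MetricGraph

variable {V : Type*} (M : MetricGraph V)

/-- The square of the `L²` norm of `f` over the metric graph. Each edge is counted once by each
of its two darts, hence the factor `1/2`. -/
def sqNorm (f : M.Point → ℂ) : ℝ≥0∞ :=
  2⁻¹ * ∑' d : M.graph.Dart, ∫⁻ t in Icc 0 (M.len d), ‖M.onEdge f d t‖ₑ ^ 2

/-- The square of the `L²` norm of the derivative of `f` over the metric graph. -/
def sqNormDeriv (f : M.Point → ℂ) : ℝ≥0∞ :=
  2⁻¹ * ∑' d : M.graph.Dart, ∫⁻ t in Icc 0 (M.len d), ‖M.derivOnEdge f d t‖ₑ ^ 2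

/-- The `H¹` norm, infinite if `f` or its derivative is not square integrable. -/
def normH1 (f : M.Point → ℂ) : ℝ≥0∞ := (M.sqNorm f + M.sqNormDeriv f) ^ (1 / 2 : ℝ)

/-- The Sobolev space `H¹` of the metric graph. -/
def H1 : Set (M.Point → ℂ) :=
  {f | Continuous f ∧ (∀ d, MemSobolevOne (M.len d) (M.onEdge f d)) ∧
    M.sqNorm f < ∞ ∧ M.sqNormDeriv f < ∞}

/-- The domain of the pre-minimal Kirchhoff Laplacian: functions that are `H²` on each edge, are
continuous, satisfy the Kirchhoff condition at each vertex (the outgoing derivatives along the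
finitely many edges at the vertex sum up to zero), and vanish outside finitely many edges. -/
def kirchhoffDomain : Set (M.Point → ℂ) :=
  {f | Continuous f ∧ (∀ d, MemSobolevTwo (M.len d) (M.onEdge f d)) ∧
    (∀ v : V, ∑ᶠ d : {d : M.graph.Dart // d.fst = v}, M.derivOnEdge f d.1 0 = 0) ∧
    {d : M.graph.Dart | ∃ t, f (M.pt d t) ≠ 0}.Finite}

/-- The space `H¹₀`: the closure of the pre-minimal domain in `H¹`, in the `H¹` norm. -/
def H1Zero : Set (M.Point → ℂ) :=
  {f | f ∈ M.H1 ∧ ∀ ε : ℝ≥0∞, 0 < ε → ∃ g ∈ M.kirchhoffDomain, M.normH1 (f - g) < ε}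

end MetricGraph

end

/-! The basic estimate is that on one edge `‖f x‖² - ‖f y‖² ≤ ∫ 2‖f‖‖f'‖ ≤ edgeEnergy`, with a
constant that does not depend on the length of the edge
(`AbsolutelyContinuousOnInterval.enorm_sq_le_add_edgeEnergy`). Summed along a path, it bounds the
change of `‖f‖²` by the energy of the edges traversed, so no lower bound on edge lengths is needed.

Closure implies vanishing: along a fixed ray, the values of `f - g` are bounded by a constant times
its energy (`EdgewiseAC.ray_le`), and an element `g` of the pre-minimal domain vanishes far out on
the ray. Hence `f` tends to zero along every ray. A graph end corresponding to a given topological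
end is produced by building a ray that runs through the sets `U n` (`TopEnd.exists_corresponds`).

Vanishing implies closure: if `‖f‖ > δ` at infinitely many vertices, these accumulate at some end,
described by nested connected vertex sets `C n` that leave every finite set
(`exists_endSeq_of_infinite`). For large `n` the energy on `C n` is tiny, and `C n` contains a ray
along which `f` tends to zero; a path inside `C n` from a vertex with `‖f‖ > δ` to that ray
contradicts the basic estimate. So `f` is small at all but finitely many vertices
(`finite_lt_norm_of_hasEndValue_zero`).

For such an `f`, soft thresholding makes all but finitely many vertex values zero without increasing
the energy. Each edge function is then replaced by a smooth one with the thresholded end values and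
with zero derivative at both ends, so that the Kirchhoff condition holds term by term
(`mem_H1Zero_of_finite_lt_norm`). The error is controlled on finitely many edges by smallness of the
threshold, and on the others by the tail of the energy. -/

noncomputable section

/-- The square of the `H¹` norm of a function on `[0, L]`. -/
def edgeEnergy (L : ℝ) (g : ℝ → ℂ) : ℝ≥0∞ :=
  (∫⁻ t in Icc 0 L, ‖g t‖ₑ ^ 2) + ∫⁻ t in Icc 0 L, ‖derivWithin g (Icc 0 L) t‖ₑ ^ 2

/-! ### Absolutely continuous functions and estimates on a single edge -/

section AbsolutelyContinuous

variable {X Y : Type*} [PseudoMetricSpace X] [PseudoMetricSpace Y] {a b : ℝ}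

theorem LipschitzWith.comp_absolutelyContinuousOnInterval {F : X → Y} {K : NNReal}
    (hF : LipschitzWith K F) {f : ℝ → X} (hf : AbsolutelyContinuousOnInterval f a b) :
    AbsolutelyContinuousOnInterval (F ∘ f) a b := by
  have h : Tendsto (fun E : ℕ × (ℕ → ℝ × ℝ) =>
      (K : ℝ) * ∑ i ∈ Finset.range E.1, dist (f (E.2 i).1) (f (E.2 i).2)) _ _ :=
    Tendsto.const_mul (K : ℝ) hf
  rw [mul_zero] at h
  refine squeeze_zero (fun t => Finset.sum_nonneg fun i _ => dist_nonneg) (fun t => ?_) h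
  rw [Finset.mul_sum]
  exact Finset.sum_le_sum fun i _ => hF.dist_le_mul _ _

theorem AbsolutelyContinuousOnInterval.congr {f g : ℝ → X}
    (hf : AbsolutelyContinuousOnInterval f a b) (h : EqOn f g (uIcc a b)) :
    AbsolutelyContinuousOnInterval g a b := by
  rw [absolutelyContinuousOnInterval_iff] at hf ⊢
  intro ε hε
  obtain ⟨δ, hδ, H⟩ := hf ε hε
  refine ⟨δ, hδ, fun E hE hEδ => ?_⟩
  convert! H E hE hEδ using 1
  refine Finset.sum_congr rfl fun i hi => ?_
  have := hE.1 i hi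
  rw [h this.1, h this.2]

end AbsolutelyContinuous

/-- Absolute continuity gives bounded variation, hence differentiability almost everywhere. The end
points form a null set, and inside the interval `derivWithin` is the ordinary derivative. -/
theorem ae_hasDerivAt_of_absolutelyContinuous {f : ℝ → ℂ} {L : ℝ} (hL : 0 < L)
    (hf : AbsolutelyContinuousOnInterval f 0 L) :
    ∀ᵐ t ∂(volume.restrict (Icc 0 L)), HasDerivAt f (derivWithin f (Icc 0 L) t) t := by
  have h := hf.boundedVariationOn.ae_differentiableAt_of_mem_uIcc
  rw [uIcc_of_le hL.le] at h
  rw [Measure.restrict_congr_set Ioo_ae_eq_Icc.symm]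
  rw [ae_restrict_iff' measurableSet_Ioo]
  filter_upwards [h] with t ht htL
  have hd := ht (Ioo_subset_Icc_self htL)
  rw [derivWithin_of_mem_nhds (Icc_mem_nhds htL.1 htL.2)]
  exact hd.hasDerivAt

theorem LipschitzWith.norm_deriv_comp_le {E G : Type*} [NormedAddCommGroup E] [NormedSpace ℝ E]
    [NormedAddCommGroup G] [NormedSpace ℝ G] {F : E → G} (hF : LipschitzWith 1 F) {f : ℝ → E}
    {f' : E} {g' : G} {t : ℝ} (hf : HasDerivAt f f' t) (hg : HasDerivAt (F ∘ f) g' t) :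
    ‖g'‖ ≤ ‖f'‖ := by
  refine le_of_forall_pos_le_add fun ε hε => ?_
  refine hg.le_of_lip' (by positivity) ?_
  have h := (hasDerivAt_iff_isLittleO.1 hf).def hε
  filter_upwards [h] with x hx
  have h1 := hF.dist_le_mul (f x) (f t)
  rw [dist_eq_norm, dist_eq_norm, NNReal.coe_one, one_mul] at h1
  have h2 : ‖f x - f t‖ ≤ ‖f x - f t - (x - t) • f'‖ + ‖(x - t) • f'‖ := by
    simpa using norm_add_le (f x - f t - (x - t) • f') ((x - t) • f')
  rw [norm_smul] at h2
  simp only [Function.comp_apply]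
  nlinarith

theorem enorm_sub_le_lintegral_deriv {φ : ℝ → ℝ} {L : ℝ} (hL : 0 < L)
    (hφ : AbsolutelyContinuousOnInterval φ 0 L) {x y : ℝ} (hx : x ∈ Icc 0 L) (hy : y ∈ Icc 0 L) :
    ‖φ x - φ y‖ₑ ≤ ∫⁻ t in Icc 0 L, ‖deriv φ t‖ₑ := by
  have hsub : uIcc y x ⊆ Icc 0 L := uIcc_subset_Icc hy hx
  have h := (hφ.mono (by rwa [uIcc_of_le hL.le] : uIcc y x ⊆ uIcc 0 L)).integral_deriv_eq_sub
  rw [← h, ← ofReal_norm, intervalIntegral.norm_integral_eq_norm_integral_uIoc, ofReal_norm]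
  exact (enorm_integral_le_lintegral_enorm _).trans
    (lintegral_mono_set (uIoc_subset_uIcc.trans hsub))

/-- Reduction to the real case: the function `‖f - f y‖` vanishes at `y`, and its derivative is
almost everywhere at most `‖f'‖`, since the norm is 1-Lipschitz. -/
theorem AbsolutelyContinuousOnInterval.enorm_sub_le {f : ℝ → ℂ} {L : ℝ} (hL : 0 < L)
    (hf : AbsolutelyContinuousOnInterval f 0 L) {x y : ℝ} (hx : x ∈ Icc 0 L)
    (hy : y ∈ Icc 0 L) :
    ‖f x - f y‖ₑ ≤ ∫⁻ t in Icc 0 L, ‖derivWithin f (Icc 0 L) t‖ₑ := by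
  have hF : LipschitzWith 1 fun z : ℂ => ‖z - f y‖ :=
    LipschitzWith.of_dist_le_mul fun z w => by
      simpa [Real.dist_eq, dist_eq_norm] using abs_norm_sub_norm_le (z - f y) (w - f y)
  have hAC := hF.comp_absolutelyContinuousOnInterval hf
  have h := enorm_sub_le_lintegral_deriv hL hAC hx hy
  simp only [Function.comp_apply, sub_self, norm_zero, sub_zero, enorm_norm] at h
  refine h.trans (lintegral_mono_ae ?_)
  filter_upwards [ae_hasDerivAt_of_absolutelyContinuous hL hf] with t ht
  by_cases hd : DifferentiableAt ℝ ((fun z : ℂ => ‖z - f y‖) ∘ f) t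
  · rw [← ofReal_norm, ← ofReal_norm]
    exact ENNReal.ofReal_le_ofReal (hF.norm_deriv_comp_le ht hd.hasDerivAt)
  · rw [deriv_zero_of_not_differentiableAt hd]
    simp

/-- The derivative of `‖f‖²` is `2⟪f, f'⟫`, which is bounded by `‖f‖² + ‖f'‖²`. Squaring is what
makes the bound independent of `L`. -/
theorem AbsolutelyContinuousOnInterval.enorm_sq_le_add_edgeEnergy {f : ℝ → ℂ} {L : ℝ} (hL : 0 < L)
    (hf : AbsolutelyContinuousOnInterval f 0 L) {x y : ℝ} (hx : x ∈ Icc 0 L)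
    (hy : y ∈ Icc 0 L) :
    ‖f x‖ₑ ^ 2 ≤ ‖f y‖ₑ ^ 2 + edgeEnergy L f := by
  have hn : AbsolutelyContinuousOnInterval (fun t => ‖f t‖) 0 L :=
    (lipschitzWith_one_norm (E := ℂ)).comp_absolutelyContinuousOnInterval hf
  have hAC : AbsolutelyContinuousOnInterval (fun t => ‖f t‖ ^ 2) 0 L :=
    (hn.mul hn).congr fun t _ => by simp [sq]
  have h := enorm_sub_le_lintegral_deriv hL hAC hx hy
  have hE : ∫⁻ t in Icc 0 L, ‖deriv (fun t => ‖f t‖ ^ 2) t‖ₑ ≤ edgeEnergy L f := by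
    have hc := hf.continuousOn
    rw [uIcc_of_le hL.le] at hc
    have hm := ((hc.aemeasurable (μ := volume) measurableSet_Icc).enorm.pow_const 2)
    rw [edgeEnergy, ← lintegral_add_left' hm]
    refine lintegral_mono_ae ?_
    filter_upwards [ae_hasDerivAt_of_absolutelyContinuous hL hf] with t ht
    rw [ht.norm_sq.deriv, ← ofReal_norm, ← ofReal_norm, ← ofReal_norm,
      ← ENNReal.ofReal_pow (norm_nonneg _), ← ENNReal.ofReal_pow (norm_nonneg _),
      ← ENNReal.ofReal_add (by positivity) (by positivity)]
    refine ENNReal.ofReal_le_ofReal ?_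
    have h1 := norm_inner_le_norm (𝕜 := ℝ) (f t) (derivWithin f (Icc 0 L) t)
    rw [norm_mul, Real.norm_ofNat]
    nlinarith [sq_nonneg (‖f t‖ - ‖derivWithin f (Icc 0 L) t‖)]
  have h2 : ‖f x‖ₑ ^ 2 = ‖‖f x‖ ^ 2‖ₑ := by rw [enorm_pow, enorm_norm]
  have h3 : ‖f y‖ₑ ^ 2 = ‖‖f y‖ ^ 2‖ₑ := by rw [enorm_pow, enorm_norm]
  rw [h2, h3]
  calc ‖‖f x‖ ^ 2‖ₑ = ‖‖f y‖ ^ 2 + (‖f x‖ ^ 2 - ‖f y‖ ^ 2)‖ₑ := by rw [add_sub_cancel]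
    _ ≤ _ := (enorm_add_le _ _).trans (add_le_add le_rfl (h.trans hE))

/-- Integrate the preceding bound over the second point `y`. This is where the length of the edge
enters. -/
theorem ofReal_mul_enorm_sq_le_edgeEnergy {f : ℝ → ℂ} {L : ℝ} (hL : 0 < L)
    (hf : AbsolutelyContinuousOnInterval f 0 L) {x : ℝ} (hx : x ∈ Icc 0 L) :
    ENNReal.ofReal L * ‖f x‖ₑ ^ 2 ≤ (1 + ENNReal.ofReal L) * edgeEnergy L f := by
  have h : ∫⁻ _ in Icc 0 L, ‖f x‖ₑ ^ 2 ≤ ∫⁻ y in Icc 0 L, (‖f y‖ₑ ^ 2 + edgeEnergy L f) :=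
    setLIntegral_mono' measurableSet_Icc fun y hy => hf.enorm_sq_le_add_edgeEnergy hL hx hy
  rw [lintegral_add_right _ measurable_const] at h
  simp only [lintegral_const, MeasurableSet.univ, Measure.restrict_apply, univ_inter,
    Real.volume_Icc, sub_zero] at h
  rw [mul_comm, add_mul, one_mul, mul_comm (ENNReal.ofReal L)]
  exact h.trans (add_le_add (le_self_add) le_rfl)

theorem enorm_add_sq_le (x y : ℂ) : ‖x + y‖ₑ ^ 2 ≤ 2 * ‖x‖ₑ ^ 2 + 2 * ‖y‖ₑ ^ 2 := by
  rw [← ofReal_norm, ← ofReal_norm, ← ofReal_norm, ← ENNReal.ofReal_pow (norm_nonneg _),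
    ← ENNReal.ofReal_pow (norm_nonneg _), ← ENNReal.ofReal_pow (norm_nonneg _),
    ← ENNReal.ofReal_ofNat 2, ← ENNReal.ofReal_mul (by norm_num),
    ← ENNReal.ofReal_mul (by norm_num), ← ENNReal.ofReal_add (by positivity) (by positivity)]
  refine ENNReal.ofReal_le_ofReal ?_
  have := norm_add_le x y
  nlinarith [norm_nonneg (x + y), sq_nonneg (‖x‖ - ‖y‖)]

/-! ### Edge energies and Sobolev functions under sums, reversal and change outside the edge -/

section Congr

variable {L : ℝ} {f g : ℝ → ℂ}

theorem edgeEnergy_congr (h : EqOn f g (Icc 0 L)) : edgeEnergy L f = edgeEnergy L g := by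
  unfold edgeEnergy
  congr 1
  · exact setLIntegral_congr_fun measurableSet_Icc fun _ ht => by simp [h ht]
  · exact setLIntegral_congr_fun measurableSet_Icc fun _ ht => by
      simp [derivWithin_congr h (h ht)]

theorem MemSobolevOne.congr (hL : 0 ≤ L) (hf : MemSobolevOne L f) (h : EqOn f g (Icc 0 L)) :
    MemSobolevOne L g := by
  refine ⟨hf.1.congr (by rwa [uIcc_of_le hL]), hf.2.ae_eq ?_⟩
  filter_upwards [ae_restrict_mem measurableSet_Icc] with t ht
  exact derivWithin_congr h (h ht)

theorem MemSobolevTwo.congr (hL : 0 ≤ L) (hf : MemSobolevTwo L f) (h : EqOn f g (Icc 0 L)) :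
    MemSobolevTwo L g :=
  ⟨hf.1.congr hL h, hf.2.1.congr fun _ ht => (h ht).symm,
    hf.2.2.congr hL fun _ ht => derivWithin_congr h (h ht)⟩

theorem edgeEnergy_add_le (hL : 0 < L) (hf : AbsolutelyContinuousOnInterval f 0 L)
    (hg : AbsolutelyContinuousOnInterval g 0 L) :
    edgeEnergy L (f + g) ≤ 2 * edgeEnergy L f + 2 * edgeEnergy L g := by
  have key : ∀ u v : ℝ → ℂ, AEMeasurable u (volume.restrict (Icc 0 L)) →
      ∫⁻ t in Icc 0 L, ‖u t + v t‖ₑ ^ 2 ≤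
        2 * (∫⁻ t in Icc 0 L, ‖u t‖ₑ ^ 2) + 2 * ∫⁻ t in Icc 0 L, ‖v t‖ₑ ^ 2 := by
    intro u v hu
    rw [← lintegral_const_mul' _ _ (by simp), ← lintegral_const_mul' _ _ (by simp),
      ← lintegral_add_left' ((hu.enorm.pow_const 2).const_mul 2)]
    exact lintegral_mono fun t => enorm_add_sq_le _ _
  have hc := hf.continuousOn
  rw [uIcc_of_le hL.le] at hc
  have hd : AEMeasurable (derivWithin f (Icc 0 L)) (volume.restrict (Icc 0 L)) := by
    refine AEMeasurable.congr (measurable_deriv f).aemeasurable ?_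
    filter_upwards [ae_hasDerivAt_of_absolutelyContinuous hL hf] with t ht using ht.deriv
  have h1 := key f g (hc.aemeasurable measurableSet_Icc)
  have h2 := key (derivWithin f (Icc 0 L)) (derivWithin g (Icc 0 L)) hd
  have h3 : ∫⁻ t in Icc 0 L, ‖derivWithin (f + g) (Icc 0 L) t‖ₑ ^ 2 =
      ∫⁻ t in Icc 0 L, ‖derivWithin f (Icc 0 L) t + derivWithin g (Icc 0 L) t‖ₑ ^ 2 := by
    refine lintegral_congr_ae ?_
    filter_upwards [ae_hasDerivAt_of_absolutelyContinuous hL hf,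
      ae_hasDerivAt_of_absolutelyContinuous hL hg, ae_restrict_mem measurableSet_Icc]
      with t h1 h2 ht
    rw [derivWithin_add h1.differentiableAt.differentiableWithinAt
      h2.differentiableAt.differentiableWithinAt]
  unfold edgeEnergy
  rw [h3]
  refine (add_le_add h1 h2).trans (le_of_eq ?_)
  ring

theorem edgeEnergy_neg : edgeEnergy L (-f) = edgeEnergy L f := by
  simp [edgeEnergy, derivWithin.neg]

theorem edgeEnergy_sub_le (hL : 0 < L) (hf : AbsolutelyContinuousOnInterval f 0 L)
    (hg : AbsolutelyContinuousOnInterval g 0 L) :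
    edgeEnergy L (f - g) ≤ 2 * edgeEnergy L f + 2 * edgeEnergy L g := by
  rw [sub_eq_add_neg, ← edgeEnergy_neg (f := g)]
  exact edgeEnergy_add_le hL hf hg.neg

theorem image_sub_Icc_zero (L : ℝ) : (fun t => L - t) ⁻¹' Icc 0 L = Icc 0 L := by
  ext t; simp [and_comm]

theorem derivWithin_comp_reverse (t : ℝ) :
    derivWithin (fun t => f (L - t)) (Icc 0 L) t = -derivWithin f (Icc 0 L) (L - t) := by
  rw [derivWithin_comp_const_sub]
  simp

theorem lintegral_reverse (u : ℝ → ℝ≥0∞) :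
    ∫⁻ t in Icc 0 L, u (L - t) = ∫⁻ t in Icc 0 L, u t := by
  have h := (Measure.measurePreserving_sub_left volume L).setLIntegral_comp_preimage_emb
    (MeasurableEquiv.subLeft L).measurableEmbedding u (Icc 0 L)
  rwa [image_sub_Icc_zero] at h

theorem edgeEnergy_reverse :
    edgeEnergy L (fun t => f (L - t)) = edgeEnergy L f := by
  unfold edgeEnergy
  simp_rw [derivWithin_comp_reverse, enorm_neg]
  rw [lintegral_reverse fun t => ‖f t‖ₑ ^ 2,
    lintegral_reverse fun t => ‖derivWithin f (Icc 0 L) t‖ₑ ^ 2]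

theorem ContDiff.memSobolevOne (hL : 0 < L) (hf : ContDiff ℝ 1 f) : MemSobolevOne L f := by
  refine ⟨hf.contDiffOn.absolutelyContinuousOnInterval, ?_⟩
  have hc : ContinuousOn (derivWithin f (Icc 0 L)) (Icc 0 L) :=
    hf.contDiffOn.continuousOn_derivWithin (uniqueDiffOn_Icc hL) le_rfl
  obtain ⟨C, hC⟩ := isCompact_Icc.exists_bound_of_continuousOn hc
  refine MemLp.of_bound (hc.aestronglyMeasurable measurableSet_Icc) C ?_
  filter_upwards [ae_restrict_mem measurableSet_Icc] with t ht using hC t ht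

theorem ContDiff.memSobolevTwo (hL : 0 < L) (hf : ContDiff ℝ 2 f) : MemSobolevTwo L f := by
  have h1 : ContDiff ℝ 1 f := hf.of_le (by norm_num)
  refine ⟨h1.memSobolevOne hL, (h1.differentiable one_ne_zero).differentiableOn, ?_⟩
  have h2 : ContDiff ℝ 1 (deriv f) := ((contDiff_succ_iff_deriv (n := 1)).1 hf).2.2
  refine (h2.memSobolevOne hL).congr hL.le fun t ht => ?_
  exact ((h1.differentiable one_ne_zero t).derivWithin (uniqueDiffOn_Icc hL t ht)).symm

end Congr

/-! ### Soft thresholding -/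

section SoftThreshold

/-- Real soft thresholding at level `δ`. -/
def softThresholdReal (δ x : ℝ) : ℝ := x - max (-δ) (min δ x)

/-- Soft thresholding at level `δ` of the real and the imaginary part. -/
def softThreshold (δ : ℝ) (z : ℂ) : ℂ := ⟨softThresholdReal δ z.re, softThresholdReal δ z.im⟩

variable {δ : ℝ}

theorem abs_softThresholdReal_sub_le (hδ : 0 ≤ δ) (x y : ℝ) :
    |softThresholdReal δ x - softThresholdReal δ y| ≤ |x - y| := by
  unfold softThresholdReal
  grind

theorem lipschitzWith_softThreshold (hδ : 0 ≤ δ) : LipschitzWith 1 (softThreshold δ) := by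
  refine LipschitzWith.of_dist_le_mul fun z w => ?_
  rw [NNReal.coe_one, one_mul, Complex.dist_eq_re_im, Complex.dist_eq_re_im]
  refine Real.sqrt_le_sqrt (add_le_add ?_ ?_)
  · exact sq_le_sq.2 (abs_softThresholdReal_sub_le hδ _ _)
  · exact sq_le_sq.2 (abs_softThresholdReal_sub_le hδ _ _)

theorem softThreshold_eq_zero (hδ : 0 ≤ δ) {z : ℂ} (hz : ‖z‖ ≤ δ) : softThreshold δ z = 0 := by
  have h1 := (Complex.abs_re_le_norm z).trans hz
  have h2 := (Complex.abs_im_le_norm z).trans hz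
  apply Complex.ext <;> simp only [softThreshold, softThresholdReal, Complex.zero_re,
    Complex.zero_im] <;> grind

theorem norm_softThreshold_le (hδ : 0 ≤ δ) (z : ℂ) : ‖softThreshold δ z‖ ≤ ‖z‖ := by
  have h := (lipschitzWith_softThreshold hδ).dist_le_mul z 0
  rw [softThreshold_eq_zero (z := 0) hδ (by simpa using hδ)] at h
  simpa using h

theorem norm_softThreshold_sub_le (hδ : 0 ≤ δ) (z : ℂ) : ‖softThreshold δ z - z‖ ≤ 2 * δ := by
  refine (Complex.norm_le_abs_re_add_abs_im _).trans ?_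
  simp only [softThreshold, softThresholdReal, Complex.sub_re, Complex.sub_im]
  grind

variable {L : ℝ} {f : ℝ → ℂ}

theorem norm_derivWithin_softThreshold_comp_le (hL : 0 < L) (hδ : 0 ≤ δ)
    (hf : AbsolutelyContinuousOnInterval f 0 L) :
    ∀ᵐ t ∂(volume.restrict (Icc 0 L)),
      ‖derivWithin (softThreshold δ ∘ f) (Icc 0 L) t‖ ≤ ‖derivWithin f (Icc 0 L) t‖ := by
  have hS := lipschitzWith_softThreshold hδ
  filter_upwards [ae_hasDerivAt_of_absolutelyContinuous hL hf,
    ae_hasDerivAt_of_absolutelyContinuous hL (hS.comp_absolutelyContinuousOnInterval hf)]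
    with t h1 h2 using hS.norm_deriv_comp_le h1 h2

/-- Thresholding is 1-Lipschitz and fixes zero, so it increases neither the modulus nor, almost
everywhere, the derivative. -/
theorem edgeEnergy_softThreshold_comp_le (hL : 0 < L) (hδ : 0 ≤ δ)
    (hf : AbsolutelyContinuousOnInterval f 0 L) :
    edgeEnergy L (softThreshold δ ∘ f) ≤ edgeEnergy L f := by
  refine add_le_add (lintegral_mono fun t => ?_) (lintegral_mono_ae ?_)
  · exact pow_le_pow_left' (enorm_le_iff_norm_le.2 (norm_softThreshold_le hδ _)) 2
  · filter_upwards [norm_derivWithin_softThreshold_comp_le hL hδ hf] with t ht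
    exact pow_le_pow_left' (enorm_le_iff_norm_le.2 ht) 2

theorem aestronglyMeasurable_derivWithin (hL : 0 < L)
    (hf : AbsolutelyContinuousOnInterval f 0 L) :
    AEStronglyMeasurable (derivWithin f (Icc 0 L)) (volume.restrict (Icc 0 L)) := by
  refine AEStronglyMeasurable.congr (measurable_deriv f).aestronglyMeasurable ?_
  filter_upwards [ae_hasDerivAt_of_absolutelyContinuous hL hf] with t ht using ht.deriv

theorem MemSobolevOne.softThreshold_comp (hL : 0 < L) (hδ : 0 ≤ δ) (hf : MemSobolevOne L f) :
    MemSobolevOne L (softThreshold δ ∘ f) := by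
  have hAC := (lipschitzWith_softThreshold hδ).comp_absolutelyContinuousOnInterval hf.1
  exact ⟨hAC, hf.2.mono (aestronglyMeasurable_derivWithin hL hAC)
    (norm_derivWithin_softThreshold_comp_le hL hδ hf.1)⟩

end SoftThreshold

/-! ### Smooth approximation on an edge with prescribed end data -/

section Approximation

variable {L : ℝ}

theorem eLpNorm_two_sq {α : Type*} [MeasurableSpace α] (μ : Measure α) (u : α → ℂ) :
    eLpNorm u 2 μ ^ 2 = ∫⁻ x, ‖u x‖ₑ ^ 2 ∂μ := by
  have h := eLpNorm_nnreal_pow_eq_lintegral (μ := μ) (f := u) (p := 2) (by norm_num)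
  simp only [NNReal.coe_ofNat, ENNReal.coe_ofNat, ENNReal.rpow_ofNat] at h
  exact h

theorem tendsto_lintegral_endpoint_powers (hL : 0 < L) (a b : ℂ) :
    Tendsto (fun N : ℕ => ∫⁻ t in Icc 0 L,
      ‖((1 - t / L) ^ (N + 1) : ℝ) • a + ((t / L) ^ (N + 1) : ℝ) • b‖ₑ ^ 2) atTop (𝓝 0) := by
  have h0 : ∫⁻ _ in Icc 0 L, (0 : ℝ≥0∞) = 0 := by simp
  rw [← h0]
  refine tendsto_lintegral_of_dominated_convergence (fun _ => (‖a‖ₑ + ‖b‖ₑ) ^ 2)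
    (fun N => by fun_prop) (fun N => ?_) ?_ ?_
  · filter_upwards [ae_restrict_mem measurableSet_Icc] with t ht
    have h1 : t / L ≤ 1 := (div_le_one hL).2 ht.2
    have h2 : 0 ≤ t / L := div_nonneg ht.1 hL.le
    refine pow_le_pow_left' ((enorm_add_le _ _).trans (add_le_add ?_ ?_)) 2
    · rw [enorm_le_iff_norm_le, norm_smul]
      refine mul_le_of_le_one_left (norm_nonneg _) ?_
      rw [Real.norm_of_nonneg (pow_nonneg (by linarith) _)]
      exact pow_le_one₀ (by linarith) (by linarith)
    · rw [enorm_le_iff_norm_le, norm_smul]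
      refine mul_le_of_le_one_left (norm_nonneg _) ?_
      rw [Real.norm_of_nonneg (pow_nonneg (by linarith) _)]
      exact pow_le_one₀ (by linarith) (by linarith)
  · simp [ENNReal.mul_eq_top]
  · rw [Measure.restrict_congr_set Ioo_ae_eq_Icc.symm]
    filter_upwards [ae_restrict_mem measurableSet_Ioo] with t ht
    have h1 : t / L < 1 := (div_lt_one hL).2 ht.2
    have h2 : 0 < t / L := div_pos ht.1 hL
    have h3 : Tendsto (fun N : ℕ => (1 - t / L) ^ (N + 1)) atTop (𝓝 0) :=
      (tendsto_add_atTop_iff_nat 1).2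
        (tendsto_pow_atTop_nhds_zero_of_lt_one (by linarith) (by linarith))
    have h4 : Tendsto (fun N : ℕ => (t / L) ^ (N + 1)) atTop (𝓝 0) :=
      (tendsto_add_atTop_iff_nat 1).2 (tendsto_pow_atTop_nhds_zero_of_lt_one h2.le h1)
    have h5 := ((h3.smul_const a).add (h4.smul_const b)).enorm
    simp only [zero_smul, add_zero, enorm_zero] at h5
    simpa using ENNReal.Tendsto.pow (n := 2) h5

/-- Smooth functions that vanish at both end points are dense in `L²[0, L]`. -/
theorem exists_contDiff_endpoints_zero_eLpNorm_sub_le (hL : 0 < L) {u : ℝ → ℂ}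
    (hu : MemLp u 2 (volume.restrict (Icc 0 L))) {ε : ℝ} (hε : 0 < ε) :
    ∃ q : ℝ → ℂ, ContDiff ℝ 2 q ∧ q 0 = 0 ∧ q L = 0 ∧
      eLpNorm (u - q) 2 (volume.restrict (Icc 0 L)) ≤ ENNReal.ofReal ε := by
  obtain ⟨q, -, hq, hqε⟩ := hu.exist_eLpNorm_sub_le (by simp) (by norm_num) (half_pos hε)
  have hq : ContDiff ℝ 2 q := hq.of_le (WithTop.coe_le_coe.2 le_top)
  have hpos : (0 : ℝ≥0∞) < ENNReal.ofReal (ε / 2) ^ 2 := by positivity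
  obtain ⟨N, hN⟩ := ((tendsto_order.1 (tendsto_lintegral_endpoint_powers hL (q 0) (q L))).2 _
    hpos).exists
  -- This corrector carries the end values of `q` and concentrates at the end points, so its `L²`
  -- norm is small for large `N`. The exponent `N + 1` is positive, so each term vanishes at the
  -- opposite end.
  set w : ℝ → ℂ := fun t =>
    ((1 - t / L) ^ (N + 1) : ℝ) • q 0 + ((t / L) ^ (N + 1) : ℝ) • q L with hw
  have hwd : ContDiff ℝ 2 w := by fun_prop
  refine ⟨q - w, hq.sub hwd, by simp [hw], by simp [hw, hL.ne'], ?_⟩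
  have h1 : u - (q - w) = (u - q) + w := by abel
  have h2 : eLpNorm w 2 (volume.restrict (Icc 0 L)) ≤ ENNReal.ofReal (ε / 2) := by
    rw [← eLpNorm_two_sq (volume.restrict (Icc 0 L)) w] at hN
    exact (lt_of_pow_lt_pow_left' 2 hN).le
  rw [h1]
  calc _ ≤ _ := eLpNorm_add_le (hu.aestronglyMeasurable.sub hq.continuous.aestronglyMeasurable)
        hwd.continuous.aestronglyMeasurable (by norm_num)
    _ ≤ ENNReal.ofReal (ε / 2) + ENNReal.ofReal (ε / 2) := add_le_add hqε h2
    _ = _ := by rw [← ENNReal.ofReal_add (by positivity) (by positivity), add_halves]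

theorem setLIntegral_Icc_le_of_norm_le {L C : ℝ} {u : ℝ → ℂ}
    (h : ∀ t ∈ Icc 0 L, ‖u t‖ ≤ C) (hL : 0 ≤ L) :
    ∫⁻ t in Icc 0 L, ‖u t‖ₑ ^ 2 ≤ ENNReal.ofReal (L * C ^ 2) := by
  calc ∫⁻ t in Icc 0 L, ‖u t‖ₑ ^ 2 ≤ ∫⁻ _ in Icc 0 L, ENNReal.ofReal (C ^ 2) := by
        refine setLIntegral_mono' measurableSet_Icc fun t ht => ?_
        rw [← ofReal_norm, ← ENNReal.ofReal_pow (norm_nonneg _)]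
        exact ENNReal.ofReal_le_ofReal (pow_le_pow_left₀ (norm_nonneg _) (h t ht) 2)
    _ = _ := by
        rw [lintegral_const, Measure.restrict_apply_univ, Real.volume_Icc, sub_zero, mul_comm,
          ENNReal.ofReal_mul hL]

theorem contDiff_intervalIntegral {q : ℝ → ℂ} (hq : ContDiff ℝ 2 q) (a : ℝ) :
    ContDiff ℝ 2 fun t => ∫ s in a..t, q s := by
  have hd : ∀ t, HasDerivAt (fun t => ∫ s in a..t, q s) (q t) t := fun t =>
    intervalIntegral.integral_hasDerivAt_right (hq.continuous.intervalIntegrable _ _)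
      (hq.continuous.stronglyMeasurableAtFilter _ _) hq.continuous.continuousAt
  have hd' : deriv (fun t => ∫ s in a..t, q s) = q := funext fun t => (hd t).deriv
  refine (contDiff_succ_iff_deriv (n := 1)).2 ⟨fun t => (hd t).differentiableAt, by simp, ?_⟩
  rw [hd']
  exact hq.of_le (by norm_num)

/-- Functions in `H¹[0, L]` are approximated by smooth functions with prescribed values at the
end points, close to those of the given function, and with derivative zero there. -/
theorem MemSobolevOne.exists_contDiff_edgeEnergy_sub_le (hL : 0 < L) {f : ℝ → ℂ}
    (hf : MemSobolevOne L f) {ε : ℝ≥0∞} (hε : 0 < ε) :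
    ∃ δ : ℝ, 0 < δ ∧ ∀ a b : ℂ, ‖a - f 0‖ ≤ δ → ‖b - f L‖ ≤ δ →
      ∃ p : ℝ → ℂ, ContDiff ℝ 2 p ∧ p 0 = a ∧ p L = b ∧ deriv p 0 = 0 ∧ deriv p L = 0 ∧
        edgeEnergy L (f - p) ≤ ε := by
  -- The parameter `η` bounds both the `L²` error of the derivative and the deviation of the end
  -- values. The three terms bound the `L²` norm of the function error, the derivative error from
  -- `q`, and the derivative of the cubic correction; all tend to zero with `η`.
  obtain ⟨η, hη, hηε⟩ : ∃ η : ℝ, 0 < η ∧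
      ENNReal.ofReal (L * (η * √L + (3 * η + η * √L)) ^ 2) +
        (2 * ENNReal.ofReal (η ^ 2) +
          2 * ENNReal.ofReal (L * ((3 * η + η * √L) * (6 / L)) ^ 2)) ≤ ε := by
    have hc : Continuous fun η : ℝ => ENNReal.ofReal (L * (η * √L + (3 * η + η * √L)) ^ 2) +
        (2 * ENNReal.ofReal (η ^ 2) +
          2 * ENNReal.ofReal (L * ((3 * η + η * √L) * (6 / L)) ^ 2)) := by
      refine (ENNReal.continuous_ofReal.comp (by fun_prop)).add (Continuous.add (f := fun η : ℝ => 2 * ENNReal.ofReal (η ^ 2)) ?_ ?_)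
      · exact (ENNReal.continuous_const_mul (by simp)).comp
          (ENNReal.continuous_ofReal.comp (by fun_prop))
      · exact (ENNReal.continuous_const_mul (by simp)).comp
          (ENNReal.continuous_ofReal.comp (by fun_prop))
    have h0 := hc.tendsto 0
    simp only [zero_mul, mul_zero, add_zero, ne_eq, OfNat.ofNat_ne_zero, not_false_eq_true,
      zero_pow, ENNReal.ofReal_zero] at h0
    have h1 := (h0.mono_left (nhdsWithin_le_nhds (s := Ioi 0))).eventually (ge_mem_nhds hε)
    obtain ⟨η, h2, h3⟩ := (h1.and self_mem_nhdsWithin).exists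
    exact ⟨η, h3, h2⟩
  refine ⟨η, hη, fun a b ha hb => ?_⟩
  obtain ⟨q, hq, hq0, hqL, hqη⟩ := exists_contDiff_endpoints_zero_eLpNorm_sub_le hL hf.2 hη
  set P : ℝ → ℂ := fun t => f 0 + ∫ s in 0..t, q s with hP
  have hPc : ContDiff ℝ 2 P := contDiff_const.add (contDiff_intervalIntegral hq 0)
  have hPd : ∀ t, HasDerivAt P (q t) t := fun t =>
    (intervalIntegral.integral_hasDerivAt_right (hq.continuous.intervalIntegrable _ _)
      (hq.continuous.stronglyMeasurableAtFilter _ _) hq.continuous.continuousAt).const_add _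
  have hP0 : P 0 = f 0 := by simp [hP]
  have hPAC : AbsolutelyContinuousOnInterval P 0 L :=
    (ContDiff.memSobolevOne hL (hPc.of_le (by norm_num))).1
  -- The difference vanishes at `0`, and the `L¹` norm of its derivative is at most `√L` times the
  -- `L²` norm.
  have hh : ∀ t ∈ Icc 0 L, ‖f t - P t‖ ≤ η * √L := by
    intro t ht
    have h := (hf.1.sub hPAC).enorm_sub_le hL ht (left_mem_Icc.2 hL.le)
    simp only [Pi.sub_apply, hP0, sub_self, sub_zero] at h
    have h1 : ∫⁻ s in Icc 0 L, ‖derivWithin (f - P) (Icc 0 L) s‖ₑ =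
        eLpNorm (derivWithin f (Icc 0 L) - q) 1 (volume.restrict (Icc 0 L)) := by
      rw [eLpNorm_one_eq_lintegral_enorm]
      refine lintegral_congr_ae ?_
      filter_upwards [ae_hasDerivAt_of_absolutelyContinuous hL hf.1,
        ae_restrict_mem measurableSet_Icc] with s hs hsL
      rw [((hs.sub (hPd s)).hasDerivWithinAt).derivWithin (uniqueDiffOn_Icc hL s hsL)]
      rfl
    have h2 := eLpNorm_le_eLpNorm_mul_rpow_measure_univ (p := 1) (q := 2) (by norm_num)
      (hf.2.aestronglyMeasurable.sub
        (hq.continuous.aestronglyMeasurable (μ := volume.restrict (Icc 0 L))))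
    have h3 : (volume.restrict (Icc 0 L) univ : ℝ≥0∞) ^
        (1 / (1 : ℝ≥0∞).toReal - 1 / (2 : ℝ≥0∞).toReal) = ENNReal.ofReal √L := by
      rw [Measure.restrict_apply_univ, Real.volume_Icc, sub_zero, Real.sqrt_eq_rpow,
        ENNReal.ofReal_rpow_of_pos hL]
      norm_num
    rw [h1] at h
    rw [h3] at h2
    have h4 : ‖f t - P t‖ₑ ≤ ENNReal.ofReal (η * √L) := by
      rw [ENNReal.ofReal_mul hη.le]
      exact h.trans (h2.trans (mul_le_mul_left hqη _))
    rw [← ofReal_norm] at h4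
    exact (ENNReal.ofReal_le_ofReal_iff (by positivity)).1 h4
  -- This cubic rises from 0 to 1 with zero slope at both ends. Interpolating between the errors `α`
  -- and `β` therefore corrects the end values of `P` and leaves its end derivatives at zero.
  set B : ℝ → ℝ := fun t => 3 * (t / L) ^ 2 - 2 * (t / L) ^ 3 with hB
  set α := a - P 0 with hα
  set β := b - P L with hβ
  have hαn : ‖α‖ ≤ η := by rw [hα, hP0]; exact ha
  have hβn : ‖β‖ ≤ η + η * √L := by
    have : β = (b - f L) + (f L - P L) := by rw [hβ]; ring
    rw [this]
    exact (norm_add_le _ _).trans (add_le_add hb (hh L (right_mem_Icc.2 hL.le)))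
  have hηL : 0 ≤ η * √L := by positivity
  have hγn : ‖β - α‖ ≤ 3 * η + η * √L := (norm_sub_le _ _).trans (by linarith)
  set c : ℝ → ℂ := fun t => α + B t • (β - α) with hc
  have hcd : ∀ t, HasDerivAt c ((6 * (t / L) * (1 - t / L) / L : ℝ) • (β - α)) t := by
    intro t
    have h1 : HasDerivAt (fun t => t / L) (1 / L) t := (hasDerivAt_id t).div_const L
    have h2 : HasDerivAt B (6 * (t / L) * (1 - t / L) / L) t := by
      convert! ((h1.pow 2).const_mul 3).sub ((h1.pow 3).const_mul 2) using 1
      norm_num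
      ring
    exact (h2.smul_const _).const_add _
  have hcc : ContDiff ℝ 2 c := by fun_prop
  have hcn : ∀ t ∈ Icc 0 L, ‖c t‖ ≤ 3 * η + η * √L := by
    intro t ht
    have h1 : t / L ≤ 1 := (div_le_one hL).2 ht.2
    have h2 : 0 ≤ t / L := div_nonneg ht.1 hL.le
    have hB0 : 0 ≤ B t := by
      have : B t = (t / L) ^ 2 * (3 - 2 * (t / L)) := by simp only [hB]; ring
      rw [this]; exact mul_nonneg (sq_nonneg _) (by linarith)
    have hB1 : 0 ≤ 1 - B t := by
      have : 1 - B t = (1 - t / L) ^ 2 * (1 + 2 * (t / L)) := by simp only [hB]; ring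
      rw [this]; exact mul_nonneg (sq_nonneg _) (by linarith)
    have h3 : c t = (1 - B t) • α + B t • β := by
      simp only [hc, smul_sub, sub_smul, one_smul]; ring
    rw [h3]
    refine (norm_add_le _ _).trans ?_
    rw [norm_smul, norm_smul, Real.norm_of_nonneg hB0, Real.norm_of_nonneg hB1]
    nlinarith [norm_nonneg α, norm_nonneg β]
  have hcn' : ∀ t ∈ Icc 0 L, ‖((6 * (t / L) * (1 - t / L) / L : ℝ) • (β - α))‖ ≤
      (3 * η + η * √L) * (6 / L) := by
    intro t ht
    have h1 : t / L ≤ 1 := (div_le_one hL).2 ht.2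
    have h2 : 0 ≤ t / L := div_nonneg ht.1 hL.le
    have h3 : 0 ≤ 1 - t / L := by linarith
    rw [norm_smul, mul_comm, Real.norm_of_nonneg (by positivity)]
    refine mul_le_mul hγn (div_le_div_of_nonneg_right ?_ hL.le) (by positivity) (by positivity)
    nlinarith
  refine ⟨P + c, hPc.add hcc, ?_, ?_, ?_, ?_, ?_⟩
  · simp [hc, hB, hα]
  · have : B L = 1 := by simp only [hB]; rw [div_self hL.ne']; norm_num
    simp [hc, this, hβ]
  · rw [((hPd 0).add (hcd 0)).deriv, hq0]; simp
  · rw [((hPd L).add (hcd L)).deriv, hqL, div_self hL.ne']; simp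
  · refine le_trans (add_le_add ?_ ?_) hηε
    · refine setLIntegral_Icc_le_of_norm_le (fun t ht => ?_) hL.le
      have : (f - (P + c)) t = (f t - P t) - c t := by simp only [Pi.sub_apply, Pi.add_apply]; ring
      rw [this]
      exact (norm_sub_le _ _).trans (add_le_add (hh t ht) (hcn t ht))
    · have h1 : ∫⁻ t in Icc 0 L, ‖(derivWithin f (Icc 0 L) - q) t‖ₑ ^ 2 ≤
          ENNReal.ofReal (η ^ 2) := by
        rw [← eLpNorm_two_sq, ENNReal.ofReal_pow hη.le]
        exact pow_le_pow_left' hqη 2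
      have h2 := setLIntegral_Icc_le_of_norm_le hcn' hL.le
      refine le_trans ?_ (add_le_add (mul_le_mul_right h1 2) (mul_le_mul_right h2 2))
      rw [← lintegral_const_mul' _ _ (by simp), ← lintegral_const_mul' _ _ (by simp),
        ← lintegral_add_right _ (by fun_prop)]
      refine lintegral_mono_ae ?_
      filter_upwards [ae_hasDerivAt_of_absolutelyContinuous hL hf.1,
        ae_restrict_mem measurableSet_Icc] with t ht htL
      rw [((ht.sub ((hPd t).add (hcd t))).hasDerivWithinAt).derivWithin
        (uniqueDiffOn_Icc hL t htL)]
      have h3 := enorm_add_sq_le ((derivWithin f (Icc 0 L) - q) t)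
        (-((6 * (t / L) * (1 - t / L) / L : ℝ) • (β - α)))
      rw [enorm_neg] at h3
      convert h3 using 3
      simp only [Pi.sub_apply]
      ring

end Approximation

namespace MetricGraph

variable {V : Type*} (M : MetricGraph V)

/-! ### Cells, open stars and spanned subgraphs -/

section Cells

/-- The final point of the interval attached to a dart. -/
def terminus (d : M.graph.Dart) : M.Interval d := ⟨M.len d, (M.len_pos d).le, le_refl _⟩

theorem pt_origin (d : M.graph.Dart) : M.pt d (M.origin d) = M.vertex d.fst :=
  Quot.sound (Glue.start d)

theorem pt_reverse (d : M.graph.Dart) (t : M.Interval d) :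
    M.pt d.symm (M.reverse d t) = M.pt d t :=
  (Quot.sound (Glue.flip d t)).symm

theorem pt_terminus (d : M.graph.Dart) : M.pt d (M.terminus d) = M.vertex d.snd := by
  rw [← M.pt_reverse d]
  refine Eq.trans ?_ (M.pt_origin d.symm)
  congr 1
  exact Subtype.ext (sub_self _)

variable {M} in
theorem point_induction {p : M.Point → Prop} (vertex : ∀ v, p (M.vertex v))
    (pt : ∀ d t, p (M.pt d t)) (x : M.Point) : p x := by
  induction x using Quot.ind with
  | mk a =>
    rcases a with v | ⟨d, t⟩
    · exact vertex v
    · exact pt d t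

theorem continuous_pt (d : M.graph.Dart) : Continuous (M.pt d) := by
  rw [continuous_iff_coinduced_le]
  exact le_iSup (fun d : M.graph.Dart => TopologicalSpace.coinduced (M.pt d) inferInstance) d

theorem isOpen_iff {U : Set M.Point} : IsOpen U ↔ ∀ d, IsOpen (M.pt d ⁻¹' U) := by
  rw [isOpen_iSup_iff]
  exact forall_congr' fun d => isOpen_coinduced

theorem continuous_iff {Y : Type*} [TopologicalSpace Y] {f : M.Point → Y} :
    Continuous f ↔ ∀ d, Continuous fun t => f (M.pt d t) := by
  rw [continuous_iSup_dom]
  exact forall_congr' fun d => continuous_coinduced_dom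

/-- The end points of the open cell containing a point: the vertex itself for a vertex, and both end
vertices of the edge for an interior point of an edge. -/
def cellEnds : M.Point → Set V :=
  Quot.lift
    (Sum.elim (fun v => {v}) fun p => {w | (w = p.1.fst ∧ (p.2 : ℝ) < M.len p.1) ∨
      (w = p.1.snd ∧ 0 < (p.2 : ℝ))}) (by
    rintro _ _ (d | ⟨d, t⟩)
    · ext w
      simp [origin, M.len_pos]
    · ext w
      simp only [Sum.elim_inr, mem_ofPred_eq, reverse, M.len_symm, sub_lt_self_iff, sub_pos]
      exact or_comm)

@[simp] theorem cellEnds_vertex (v : V) : M.cellEnds (M.vertex v) = {v} := rfl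

theorem mem_cellEnds_pt {d : M.graph.Dart} {t : M.Interval d} {w : V} :
    w ∈ M.cellEnds (M.pt d t) ↔
      (w = d.fst ∧ (t : ℝ) < M.len d) ∨ (w = d.snd ∧ 0 < (t : ℝ)) := Iff.rfl

theorem cellEnds_nonempty (x : M.Point) : (M.cellEnds x).Nonempty := by
  induction x using point_induction with
  | vertex v => exact ⟨v, rfl⟩
  | pt d t =>
    rcases t.2.1.lt_or_eq with h | h
    · exact ⟨d.snd, Or.inr ⟨rfl, h⟩⟩
    · exact ⟨d.fst, Or.inl ⟨rfl, by rw [← h]; exact M.len_pos d⟩⟩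

theorem vertex_or_interior (x : M.Point) :
    (∃ v, x = M.vertex v) ∨ ∃ d t, x = M.pt d t ∧ 0 < (t : ℝ) ∧ (t : ℝ) < M.len d := by
  induction x using point_induction with
  | vertex v => exact Or.inl ⟨v, rfl⟩
  | pt d t =>
    rcases t.2.1.lt_or_eq with h | h
    · rcases t.2.2.lt_or_eq with h' | h'
      · exact Or.inr ⟨d, t, rfl, h, h'⟩
      · exact Or.inl ⟨d.snd, by rw [← M.pt_terminus]; congr 1; exact Subtype.ext h'⟩
    · exact Or.inl ⟨d.fst, by rw [← M.pt_origin]; congr 1; exact Subtype.ext h.symm⟩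

theorem cellEnds_pt_of_interior {d : M.graph.Dart} {t : M.Interval d} (h0 : 0 < (t : ℝ))
    (h1 : (t : ℝ) < M.len d) : M.cellEnds (M.pt d t) = {d.fst, d.snd} := by
  ext w
  simp [mem_cellEnds_pt, h0, h1]

/-- The union of the open stars of the vertices in `C`. -/
def openStar (C : Set V) : Set M.Point := {x | (M.cellEnds x ∩ C).Nonempty}

theorem mem_openStar {C : Set V} {x : M.Point} :
    x ∈ M.openStar C ↔ ∃ v ∈ C, v ∈ M.cellEnds x := by
  simp only [openStar, mem_ofPred_eq, Set.Nonempty, mem_inter_iff]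
  exact exists_congr fun v => and_comm

theorem vertex_mem_openStar {C : Set V} {v : V} : M.vertex v ∈ M.openStar C ↔ v ∈ C := by
  simp [mem_openStar]

theorem isOpen_openStar (C : Set V) : IsOpen (M.openStar C) := by
  rw [isOpen_iff]
  intro d
  have : M.pt d ⁻¹' M.openStar C =
      {t : M.Interval d | d.fst ∈ C ∧ (t : ℝ) < M.len d} ∪
        {t : M.Interval d | d.snd ∈ C ∧ 0 < (t : ℝ)} := by
    ext t
    simp only [mem_preimage, mem_openStar, mem_cellEnds_pt, mem_union, mem_ofPred_eq]
    constructor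
    · rintro ⟨v, hv, ⟨rfl, h⟩ | ⟨rfl, h⟩⟩
      · exact Or.inl ⟨hv, h⟩
      · exact Or.inr ⟨hv, h⟩
    · rintro (⟨h, h'⟩ | ⟨h, h'⟩)
      · exact ⟨_, h, Or.inl ⟨rfl, h'⟩⟩
      · exact ⟨_, h, Or.inr ⟨rfl, h'⟩⟩
  rw [this]
  exact (isOpen_const.inter (isOpen_lt continuous_subtype_val continuous_const)).union
    (isOpen_const.inter (isOpen_lt continuous_const continuous_subtype_val))

/-- The subgraph spanned by the vertices in `K`, as a set of points. -/
def spanned (K : Set V) : Set M.Point := {x | M.cellEnds x ⊆ K}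

/-- This duality turns the openness of open stars into the closedness of spanned subgraphs. -/
theorem compl_spanned (K : Set V) : (M.spanned K)ᶜ = M.openStar Kᶜ := by
  ext x
  simp [spanned, openStar, Set.inter_compl_nonempty_iff]

theorem isClosed_spanned (K : Set V) : IsClosed (M.spanned K) := by
  rw [← isOpen_compl_iff, compl_spanned]
  exact M.isOpen_openStar _

theorem finite_darts_fst {K : Set V} (hK : K.Finite) : {d : M.graph.Dart | d.fst ∈ K}.Finite := by
  have h : (⋃ v ∈ K, (fun w => (v, w)) '' M.graph.neighborSet v).Finite :=
    hK.biUnion fun v _ => (M.locallyFinite v).image _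
  refine Finite.of_finite_image (f := fun d : M.graph.Dart => d.toProd) (h.subset ?_)
    (fun a _ b _ hab => SimpleGraph.Dart.ext _ _ hab)
  rintro _ ⟨d, hd, rfl⟩
  exact mem_biUnion hd ⟨d.snd, d.adj, rfl⟩

theorem isCompact_spanned {K : Set V} (hK : K.Finite) : IsCompact (M.spanned K) := by
  have h : IsCompact ((⋃ d ∈ {d : M.graph.Dart | d.fst ∈ K}, range (M.pt d)) ∪ M.vertex '' K) :=
    ((M.finite_darts_fst hK).isCompact_biUnion fun d _ =>
      isCompact_range (M.continuous_pt d)).union (hK.image _).isCompact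
  refine h.of_isClosed_subset (M.isClosed_spanned K) fun x hx => ?_
  rcases M.vertex_or_interior x with ⟨v, rfl⟩ | ⟨d, t, rfl, h0, h1⟩
  · exact Or.inr ⟨v, by simpa [spanned] using hx, rfl⟩
  · refine Or.inl (mem_biUnion ?_ (mem_range_self t))
    exact hx (by rw [M.cellEnds_pt_of_interior h0 h1]; exact mem_insert _ _)

/-- The vertices in `C` together with their neighbours. -/
def closedNeighbors (C : Set V) : Set V := {v | v ∈ C ∨ ∃ w ∈ C, M.graph.Adj v w}

theorem openStar_subset_spanned (C : Set V) : M.openStar C ⊆ M.spanned (M.closedNeighbors C) := by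
  intro x hx
  rw [mem_openStar] at hx
  obtain ⟨v, hv, hvx⟩ := hx
  rcases M.vertex_or_interior x with ⟨u, rfl⟩ | ⟨d, t, rfl, h0, h1⟩
  · intro w hw
    obtain rfl : v = u := hvx
    obtain rfl : w = v := hw
    exact Or.inl hv
  · simp only [spanned, mem_ofPred_eq]
    rw [M.cellEnds_pt_of_interior h0 h1] at hvx ⊢
    rcases hvx with rfl | rfl
    · rintro w (rfl | rfl)
      · exact Or.inl hv
      · exact Or.inr ⟨_, hv, d.adj.symm⟩
    · rintro w (rfl | rfl)
      · exact Or.inr ⟨_, hv, d.adj⟩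
      · exact Or.inl hv

theorem closure_openStar_subset (C : Set V) :
    closure (M.openStar C) ⊆ M.spanned (M.closedNeighbors C) :=
  closure_minimal (M.openStar_subset_spanned C) (M.isClosed_spanned _)

theorem isPreconnected_openStar_singleton (v : V) : IsPreconnected (M.openStar {v}) := by
  refine isPreconnected_of_forall (M.vertex v) fun x hx => ?_
  simp only [mem_openStar, mem_singleton_iff, exists_eq_left] at hx
  rcases M.vertex_or_interior x with ⟨u, rfl⟩ | ⟨d, t, rfl, h0, h1⟩
  · obtain rfl : v = u := hx
    exact ⟨{M.vertex v}, by simp [vertex_mem_openStar], rfl, rfl, isPreconnected_singleton⟩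
  · wlog hd : v = d.fst generalizing d
    · rw [M.cellEnds_pt_of_interior h0 h1] at hx
      have hv : v = d.symm.fst := by
        rcases hx with rfl | h
        · exact absurd rfl hd
        · exact h
      have := this d.symm (M.reverse d t)
        (by rw [M.pt_reverse, M.cellEnds_pt_of_interior h0 h1]; exact hx)
        (by simpa [reverse, M.len_symm] using h1) (by simpa [reverse, M.len_symm] using h0) hv
      rwa [M.pt_reverse] at this
    · subst hd
      refine ⟨M.pt d '' {s | (s : ℝ) < M.len d}, ?_, ⟨M.origin d, M.len_pos d, M.pt_origin d⟩,
        ⟨t, h1, rfl⟩, IsPreconnected.image ?_ _ (M.continuous_pt d).continuousOn⟩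
      · rintro _ ⟨s, hs, rfl⟩
        simp only [mem_openStar, mem_singleton_iff, exists_eq_left]
        exact Or.inl ⟨rfl, hs⟩
      · have : ((↑) : M.Interval d → ℝ) '' {s | (s : ℝ) < M.len d} = Ico 0 (M.len d) := by
          ext s
          simp only [mem_image, mem_ofPred_eq, Subtype.exists, mem_Icc, mem_Ico]
          grind
        rw [← IsInducing.subtypeVal.isPreconnected_image, this]
        exact isPreconnected_Ico

/-- Two vertices are joined by an edge within the vertex set `C`. -/
def AdjIn (C : Set V) (v w : V) : Prop := M.graph.Adj v w ∧ v ∈ C ∧ w ∈ C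

/-- Each single star is connected, and the stars of two adjacent vertices share the midpoint of
their edge, so connectedness of `C` as a graph passes to the union of its stars. -/
theorem isPreconnected_openStar {C : Set V}
    (hC : ∀ v ∈ C, ∀ w ∈ C, Relation.ReflTransGen (M.AdjIn C) v w) :
    IsPreconnected (M.openStar C) := by
  have h : M.openStar C = ⋃ v ∈ C, M.openStar {v} := by
    ext x
    simp [mem_openStar]
  rw [h]
  refine IsPreconnected.biUnion_of_reflTransGen
    (fun v _ => M.isPreconnected_openStar_singleton v) fun v hv w hw => ?_
  refine Relation.ReflTransGen.mono (fun a b hab => ?_) _ _ (hC v hv w hw)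
  refine ⟨?_, hab.2.1⟩
  let d : M.graph.Dart := ⟨(a, b), hab.1⟩
  have hm : M.len d / 2 ∈ Icc 0 (M.len d) := by
    have := M.len_pos d
    constructor <;> linarith
  refine ⟨M.pt d ⟨_, hm⟩, ?_, ?_⟩
  · simp only [mem_openStar, mem_singleton_iff, exists_eq_left]
    exact Or.inl ⟨rfl, half_lt_self (M.len_pos d)⟩
  · simp only [mem_openStar, mem_singleton_iff, exists_eq_left]
    exact Or.inr ⟨rfl, half_pos (M.len_pos d)⟩

end Cells

end MetricGraph

/-! ### Injective sequences through descending sets, and segments of an edge in an open set -/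

section DescendingSets

variable {V : Type*}

/-- The points from which `T` is reached by `k` steps along the relation `r`. -/
def reachIn (r : V → V → Prop) (T : Set V) : ℕ → Set V
  | 0 => T
  | k + 1 => {a | ∃ b ∈ reachIn r T k, r a b}

theorem exists_mem_reachIn {r : V → V → Prop} {T : Set V} {a b : V}
    (h : Relation.ReflTransGen r a b) (hb : b ∈ T) : ∃ k, a ∈ reachIn r T k := by
  induction h using Relation.ReflTransGen.head_induction_on with
  | refl => exact ⟨0, hb⟩
  | head hac _ ih =>
    obtain ⟨k, hk⟩ := ih
    exact ⟨k + 1, _, hk, hac⟩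

/-- A decreasing sequence of nonempty sets with empty intersection, each of them connected by a
relation, is traversed by an injective sequence whose steps belong to higher and higher levels. -/
theorem exists_injective_seq_of_descending {W : ℕ → Set V} (hW : Antitone W)
    (hne : ∀ n, (W n).Nonempty) (hemp : ∀ a, ∃ n, a ∉ W n) {E : ℕ → V → V → Prop}
    (hEW : ∀ n a b, E n a b → b ∈ W n)
    (hE : ∀ n, ∀ a ∈ W n, ∀ b ∈ W n, Relation.ReflTransGen (E n) a b) :
    ∃ (r : ℕ → V) (l : ℕ → ℕ), Function.Injective r ∧ (∀ k, E (l k) (r k) (r (k + 1))) ∧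
      Tendsto l atTop atTop := by
  classical
  -- The level `lvl a` is the first index whose set misses `a`, and `D a` is the distance from `a`
  -- to `W (lvl a)` along `E (lvl a - 1)`. Points of `W 0` have positive level, so the subtraction
  -- is harmless.
  let lvl : V → ℕ := fun a => Nat.find (hemp a)
  have hlvl : ∀ a n, a ∈ W n ↔ n < lvl a := by
    intro a n
    rw [Nat.lt_find_iff]
    constructor
    · intro h m hm
      exact fun hc => hc (hW hm h)
    · intro h
      exact not_not.1 (h n le_rfl)
  let D : V → ℕ := fun a => sInf {k | a ∈ reachIn (E (lvl a - 1)) (W (lvl a)) k}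
  -- Take the first step of a shortest path from `a` to `W (lvl a)`. It stays in `W (lvl a - 1)`, so
  -- the level cannot drop; if the level does not rise, the distance falls. This strict
  -- lexicographic progress rules out repetitions.
  have step : ∀ a ∈ W 0, ∃ b, b ∈ W 0 ∧ E (lvl a - 1) a b ∧
      (lvl a < lvl b ∨ lvl a = lvl b ∧ D b < D a) := by
    intro a ha
    have hpos := (hlvl a 0).1 ha
    obtain ⟨c, hc⟩ := hne (lvl a)
    have hreach : {k | a ∈ reachIn (E (lvl a - 1)) (W (lvl a)) k}.Nonempty :=
      exists_mem_reachIn (hE (lvl a - 1) a ((hlvl a _).2 (by omega)) c (hW (by omega) hc)) hc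
    have hD : a ∈ reachIn (E (lvl a - 1)) (W (lvl a)) (D a) := Nat.sInf_mem hreach
    rcases hk : D a with _ | k
    · rw [hk] at hD
      exact absurd ((hlvl a _).1 hD) (lt_irrefl _)
    · rw [hk] at hD
      obtain ⟨b, hb, hab⟩ := hD
      have hbW := hEW _ _ _ hab
      have h1 := (hlvl b _).1 hbW
      refine ⟨b, hW (Nat.zero_le _) hbW, hab, ?_⟩
      rcases Nat.lt_or_ge (lvl a) (lvl b) with h | h
      · exact Or.inl h
      · have heq : lvl a = lvl b := by omega
        refine Or.inr ⟨heq, Nat.lt_succ_of_le (Nat.sInf_le ?_)⟩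
        rw [mem_ofPred_eq, ← heq]
        exact hb
  choose f hf0 hfE hfb using step
  obtain ⟨x₀, hx₀⟩ := hne 0
  let s : ℕ → W 0 := fun k => (fun a : W 0 => (⟨f a a.2, hf0 a a.2⟩ : W 0))^[k] ⟨x₀, hx₀⟩
  have hs : ∀ k, (s (k + 1) : V) = f (s k) (s k).2 := fun k => by
    simp only [s, Function.iterate_succ_apply']
  have hb : ∀ k, lvl (s k) < lvl (s (k + 1)) ∨
      lvl (s k) = lvl (s (k + 1)) ∧ D (s (k + 1)) < D (s k) := fun k => by
    rw [hs]; exact hfb _ _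
  have hb' : ∀ i j, i < j → lvl (s i) < lvl (s j) ∨ lvl (s i) = lvl (s j) ∧ D (s j) < D (s i) := by
    intro i j hij
    induction j, hij using Nat.le_induction with
    | base => exact hb i
    | succ j _ ih => have := hb j; omega
  have hmono : Monotone fun k => lvl (s k) := monotone_nat_of_le_succ fun k => by
    have := hb k; omega
  have hunb : ∀ N, ∃ k, N ≤ lvl (s k) := by
    intro N
    induction N with
    | zero => exact ⟨0, Nat.zero_le _⟩
    | succ N ih =>
      -- A level bounded by `N` would stay equal to `N` from `k` on, and `D` would then decrease
      -- strictly forever.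
      by_contra! hc
      obtain ⟨k, hk⟩ := ih
      have hD : ∀ i, D (s (k + i)) + i ≤ D (s k) := by
        intro i
        induction i with
        | zero => simp
        | succ i ih =>
          have h1 := hb (k + i)
          have h2 : lvl (s k) ≤ lvl (s (k + i)) := hmono (Nat.le_add_right _ _)
          have h3 := hc (k + i + 1)
          simp only [← add_assoc] at *
          omega
      have := hD (D (s k) + 1)
      omega
  refine ⟨fun k => s k, fun k => lvl (s k) - 1, ?_, fun k => ?_, ?_⟩
  · intro i j hij
    simp only at hij
    rcases lt_trichotomy i j with h | h | h
    · have := hb' i j h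
      rw [hij] at this; omega
    · exact h
    · have := hb' j i h
      rw [hij] at this; omega
  · simp only [hs]; exact hfE _ _
  · refine tendsto_atTop_atTop.2 fun N => ?_
    obtain ⟨k, hk⟩ := hunb (N + 1)
    refine ⟨k, fun j hj => ?_⟩
    have : lvl (s k) ≤ lvl (s j) := hmono hj
    omega

/-- By compactness the complement of `S`, if nonempty, has a least element `m`. The two sets are
then `Iio m` and `S ∩ Ioi m`. -/
theorem isOpen_initial_segments {X : Type*} [LinearOrder X] [TopologicalSpace X]
    [OrderClosedTopology X] [CompactSpace X] {S : Set X} (hS : IsOpen S) :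
    IsOpen {t | ∀ s ≤ t, s ∈ S} ∧ IsOpen {t | t ∈ S ∧ ¬∀ s ≤ t, s ∈ S} := by
  rcases (Sᶜ).eq_empty_or_nonempty with h | h
  · have hS' : S = univ := compl_empty_iff.1 h
    simp [hS']
  · obtain ⟨m, hm, hmin⟩ := hS.isClosed_compl.isCompact.exists_isLeast h
    have h1 : {t | ∀ s ≤ t, s ∈ S} = Iio m := by
      ext t
      constructor
      · exact fun ht => lt_of_not_ge fun hmt => hm (ht m hmt)
      · intro ht s hs
        by_contra hsS
        exact absurd ((hmin hsS).trans hs) (not_le.2 ht)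
    have h2 : {t | t ∈ S ∧ ¬∀ s ≤ t, s ∈ S} = S ∩ Ioi m := by
      ext t
      refine and_congr_right fun ht => ?_
      have h3 : (∀ s ≤ t, s ∈ S) ↔ t < m := by
        have := congrArg (t ∈ ·) h1
        simpa using this
      rw [h3, not_lt, mem_Ioi]
      exact ⟨fun h => h.lt_of_ne fun hmt => hm (hmt ▸ ht), le_of_lt⟩
    rw [h1, h2]
    exact ⟨isOpen_Iio, hS.inter isOpen_Ioi⟩

theorem isOpen_final_segments {X : Type*} [LinearOrder X] [TopologicalSpace X]
    [OrderClosedTopology X] [CompactSpace X] {S : Set X} (hS : IsOpen S) :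
    IsOpen {t | ∀ s ≥ t, s ∈ S} ∧ IsOpen {t | t ∈ S ∧ ¬∀ s ≥ t, s ∈ S} :=
  have : CompactSpace Xᵒᵈ := ‹CompactSpace X›
  isOpen_initial_segments (X := Xᵒᵈ) hS

end DescendingSets

namespace MetricGraph

variable {V : Type*} (M : MetricGraph V)

/-! ### Edge paths in connected open sets -/

section OpenConnected

variable {M} in
theorem exists_reverse_eq {d : M.graph.Dart} (s : M.Interval d.symm) :
    ∃ t : M.Interval d, M.reverse d t = s := by
  have h1 := s.2.1
  have h2 := s.2.2.trans_eq (M.len_symm d)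
  exact ⟨⟨M.len d - s, by linarith, by linarith⟩, Subtype.ext (sub_sub_cancel _ _)⟩

theorem range_pt_symm (d : M.graph.Dart) : range (M.pt d.symm) = range (M.pt d) := by
  ext x
  constructor
  · rintro ⟨s, rfl⟩
    obtain ⟨t, rfl⟩ := exists_reverse_eq s
    exact ⟨t, (M.pt_reverse d t).symm⟩
  · rintro ⟨t, rfl⟩
    exact ⟨_, M.pt_reverse d t⟩

theorem forall_le_pt_symm_iff (d : M.graph.Dart) (t : M.Interval d) (U : Set M.Point) :
    (∀ s ≤ M.reverse d t, M.pt d.symm s ∈ U) ↔ ∀ s ≥ t, M.pt d s ∈ U := by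
  constructor
  · intro h s hs
    rw [← M.pt_reverse]
    exact h _ ((sub_le_sub_iff_left (M.len d)).2 hs)
  · intro h s hs
    obtain ⟨s, rfl⟩ := exists_reverse_eq s
    rw [M.pt_reverse]
    exact h _ ((sub_le_sub_iff_left (M.len d)).1 hs)

theorem forall_ge_pt_symm_iff (d : M.graph.Dart) (t : M.Interval d) (U : Set M.Point) :
    (∀ s ≥ M.reverse d t, M.pt d.symm s ∈ U) ↔ ∀ s ≤ t, M.pt d s ∈ U := by
  constructor
  · intro h s hs
    rw [← M.pt_reverse]
    exact h _ ((sub_le_sub_iff_left (M.len d)).2 hs)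
  · intro h s hs
    obtain ⟨s, rfl⟩ := exists_reverse_eq s
    rw [M.pt_reverse]
    exact h _ ((sub_le_sub_iff_left (M.len d)).1 hs)

/-- Two vertices are the ends of an edge contained in `U`. -/
def EdgeIn (U : Set M.Point) (a b : V) : Prop :=
  ∃ d : M.graph.Dart, d.fst = a ∧ d.snd = b ∧ range (M.pt d) ⊆ U

variable {M} in
theorem EdgeIn.symm {U : Set M.Point} {a b : V} (h : M.EdgeIn U a b) : M.EdgeIn U b a := by
  obtain ⟨d, rfl, rfl, h⟩ := h
  exact ⟨d.symm, rfl, rfl, by rwa [range_pt_symm]⟩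

variable {M} in
theorem EdgeIn.vertex_mem {U : Set M.Point} {a b : V} (h : M.EdgeIn U a b) :
    M.vertex b ∈ U := by
  obtain ⟨d, rfl, rfl, h⟩ := h
  exact h ⟨M.terminus d, M.pt_terminus d⟩

/-- Any two vertices in a connected open set are joined by a path of edges contained in it. -/
theorem reflTransGen_edgeIn {U : Set M.Point} (hU : IsOpen U) (hc : IsPreconnected U) {v w : V}
    (hv : M.vertex v ∈ U) (hw : M.vertex w ∈ U) : Relation.ReflTransGen (M.EdgeIn U) v w := by
  set A : Set V := {b | Relation.ReflTransGen (M.EdgeIn U) v b} with hA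
  have hAU : ∀ b ∈ A, M.vertex b ∈ U := by
    intro b hb
    rcases Relation.ReflTransGen.cases_tail hb with rfl | ⟨c, -, h⟩
    · exact hv
    · exact h.vertex_mem
  have hAE : ∀ a b, a ∈ A → M.EdgeIn U a b → b ∈ A := fun a b ha h =>
    Relation.ReflTransGen.tail ha h
  -- A point of an edge counts as reached if the segment from it to one of the two ends lies in `U`
  -- and that end is in `A`. This respects the gluing: if a vertex is reached from the far end of an
  -- edge, the whole edge lies in `U`, so the vertex is in `A` as well.
  have key : ∀ a b, M.Glue a b →
      Sum.elim (fun b => b ∈ A) (fun p : Σ d : M.graph.Dart, M.Interval d =>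
        (p.1.fst ∈ A ∧ ∀ s ≤ p.2, M.pt p.1 s ∈ U) ∨
          (p.1.snd ∈ A ∧ ∀ s ≥ p.2, M.pt p.1 s ∈ U)) a =
      Sum.elim (fun b => b ∈ A) (fun p : Σ d : M.graph.Dart, M.Interval d =>
        (p.1.fst ∈ A ∧ ∀ s ≤ p.2, M.pt p.1 s ∈ U) ∨
          (p.1.snd ∈ A ∧ ∀ s ≥ p.2, M.pt p.1 s ∈ U)) b := by
    rintro _ _ (d | ⟨d, t⟩)
    · simp only [Sum.elim_inr, Sum.elim_inl, eq_iff_iff]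
      constructor
      · rintro (⟨h, -⟩ | ⟨h, h'⟩)
        · exact h
        · exact hAE _ _ h (EdgeIn.symm ⟨d, rfl, rfl, by
            rintro _ ⟨s, rfl⟩
            exact h' s s.2.1⟩)
      · intro h
        refine Or.inl ⟨h, fun s hs => ?_⟩
        have : s = M.origin d := le_antisymm hs s.2.1
        rw [this, M.pt_origin]
        exact hAU _ h
    · simp only [Sum.elim_inr, eq_iff_iff, forall_le_pt_symm_iff, forall_ge_pt_symm_iff]
      exact or_comm
  let P : M.Point → Prop := Quot.lift _ key
  have hO : IsOpen {x | P x} := by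
    rw [isOpen_iff]
    intro d
    have hS := hU.preimage (M.continuous_pt d)
    exact ((isOpen_const (p := d.fst ∈ A)).inter (isOpen_initial_segments hS).1).union
      ((isOpen_const (p := d.snd ∈ A)).inter (isOpen_final_segments hS).1)
  -- The reached points and the remaining points of `U` are both open, so connectedness of `U`
  -- leaves only reached points.
  have hO' : IsOpen {x | x ∈ U ∧ ¬P x} := by
    rw [isOpen_iff]
    intro d
    have hS := hU.preimage (M.continuous_pt d)
    have h : M.pt d ⁻¹' {x | x ∈ U ∧ ¬P x} =
        ({t | t ∈ M.pt d ⁻¹' U ∧ d.fst ∉ A} ∪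
          {t | t ∈ M.pt d ⁻¹' U ∧ ¬∀ s ≤ t, s ∈ M.pt d ⁻¹' U}) ∩
        ({t | t ∈ M.pt d ⁻¹' U ∧ d.snd ∉ A} ∪
          {t | t ∈ M.pt d ⁻¹' U ∧ ¬∀ s ≥ t, s ∈ M.pt d ⁻¹' U}) := by
      ext t
      have : P (M.pt d t) ↔ (d.fst ∈ A ∧ ∀ s ≤ t, s ∈ M.pt d ⁻¹' U) ∨
          (d.snd ∈ A ∧ ∀ s ≥ t, s ∈ M.pt d ⁻¹' U) := Iff.rfl
      change (M.pt d t ∈ U ∧ ¬P (M.pt d t)) ↔ _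
      rw [this]
      simp only [mem_inter_iff, mem_union, mem_ofPred_eq]
      have h' : M.pt d t ∈ U ↔ t ∈ M.pt d ⁻¹' U := Iff.rfl
      rw [h']
      tauto
    rw [h]
    exact ((hS.inter isOpen_const).union (isOpen_initial_segments hS).2).inter
      ((hS.inter isOpen_const).union (isOpen_final_segments hS).2)
  have hsub := hc.subset_left_of_subset_union hO hO'
    (disjoint_left.2 fun x hx hx' => hx'.2 hx) (fun x hx => by
      by_cases h : P x
      · exact Or.inl h
      · exact Or.inr ⟨hx, h⟩) ⟨_, hv, (Relation.ReflTransGen.refl : v ∈ A)⟩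
  exact hsub hw

end OpenConnected

/-! ### From topological ends to graph ends -/

section EndSeq

variable {M} in
theorem EndSeq.antitone (U : M.EndSeq) : Antitone U.toFun :=
  antitone_nat_of_succ_le U.succ_subset

variable {M} in
-- A connected set without vertices lies inside one edge, hence in a compact set. The closures of
-- the later sets would then be nested nonempty compact sets with a common point, which is excluded.
theorem EndSeq.exists_vertex_mem (U : M.EndSeq) (n : ℕ) : ∃ v, M.vertex v ∈ U.toFun n := by
  by_contra! hno
  obtain ⟨x, hx⟩ := (U.isConnected n).nonempty
  rcases M.vertex_or_interior x with ⟨v, rfl⟩ | ⟨d, t, rfl, h0, h1⟩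
  · exact hno v hx
  have hmem : ∀ {a : V} {y : M.Point}, y ∈ M.openStar {a} ↔ a ∈ M.cellEnds y := by
    intro a y
    simp [mem_openStar]
  -- The intersection of the two stars is the open edge. Apart from vertices, every point outside it
  -- has a cell end other than `d.fst` and `d.snd`, hence lies in the disjoint open star of the
  -- complement.
  have hsub : U.toFun n ⊆ M.openStar {d.fst} ∩ M.openStar {d.snd} := by
    refine (U.isConnected n).isPreconnected.subset_left_of_subset_union
      ((M.isOpen_openStar _).inter (M.isOpen_openStar _))
      (M.isOpen_openStar ({d.fst, d.snd} : Set V)ᶜ) ?_ ?_ ⟨_, hx, ?_⟩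
    · rw [← M.compl_spanned, disjoint_compl_right_iff_subset]
      intro y hy
      simp only [mem_inter_iff, hmem] at hy
      rcases M.vertex_or_interior y with ⟨v, rfl⟩ | ⟨d', t', rfl, h0', h1'⟩
      · exact absurd (hy.1.trans hy.2.symm) d.adj.ne
      · simp only [spanned, mem_ofPred_eq]
        rw [M.cellEnds_pt_of_interior h0' h1'] at hy ⊢
        have := d.adj.ne
        simp only [mem_insert_iff, mem_singleton_iff] at hy
        rintro w (rfl | rfl) <;> simp only [mem_insert_iff, mem_singleton_iff] <;> grind
    · intro y hy
      rcases M.vertex_or_interior y with ⟨v, rfl⟩ | ⟨d', t', rfl, h0', h1'⟩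
      · exact absurd hy (hno v)
      · simp only [mem_union, mem_inter_iff, hmem, mem_openStar,
          M.cellEnds_pt_of_interior h0' h1', mem_compl_iff, mem_insert_iff, mem_singleton_iff]
        have := d'.adj.ne
        by_cases h1 : d'.fst = d.fst ∨ d'.fst = d.snd
        · by_cases h2 : d'.snd = d.fst ∨ d'.snd = d.snd
          · left; grind
          · exact Or.inr ⟨_, h2, Or.inr rfl⟩
        · exact Or.inr ⟨_, h1, Or.inl rfl⟩
    · simp only [mem_inter_iff, hmem, M.cellEnds_pt_of_interior h0 h1]
      simp
  have hsub' : U.toFun n ⊆ M.spanned {d.fst, d.snd} := by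
    intro y hy
    rcases M.vertex_or_interior y with ⟨v, rfl⟩ | ⟨d', t', rfl, h0', h1'⟩
    · exact absurd hy (hno v)
    · have hy' := hsub hy
      simp only [mem_inter_iff, hmem, spanned, mem_ofPred_eq] at hy' ⊢
      rw [M.cellEnds_pt_of_interior h0' h1'] at hy' ⊢
      have := d.adj.ne
      simp only [mem_insert_iff, mem_singleton_iff] at hy'
      rintro w (rfl | rfl) <;> simp only [mem_insert_iff, mem_singleton_iff] <;> grind
  have hcl : ∀ m, closure (U.toFun (n + m)) ⊆ M.spanned {d.fst, d.snd} := fun m =>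
    closure_minimal ((U.antitone (Nat.le_add_right n m)).trans hsub') (M.isClosed_spanned _)
  have hcomp : IsCompact (M.spanned {d.fst, d.snd}) := M.isCompact_spanned (by simp)
  obtain ⟨y, hy⟩ := IsCompact.nonempty_iInter_of_sequence_nonempty_isCompact_isClosed
    (fun m => closure (U.toFun (n + m)))
    (fun m => closure_mono (U.antitone (by omega)))
    (fun m => (U.isConnected _).nonempty.closure)
    (hcomp.of_isClosed_subset isClosed_closure (hcl 0)) (fun m => isClosed_closure)
  have : y ∈ ⋂ m, closure (U.toFun m) := by
    refine mem_iInter.2 fun m => ?_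
    exact closure_mono (U.antitone (Nat.le_add_left m n)) (mem_iInter.1 hy m)
  rw [U.iInter_closure] at this
  exact this

variable {M} in
/-- The ray obtained by deleting the first `k` vertices. -/
def Ray.tail (R : M.Ray) (k : ℕ) : M.Ray where
  toFun n := R.toFun (n + k)
  injective _ _ h := Nat.add_right_cancel (R.injective h)
  adj n := by
    have := R.adj (n + k)
    rwa [add_right_comm] at this

variable {M} in
theorem Ray.rayEquiv_tail (R : M.Ray) (k : ℕ) : M.RayEquiv (R.tail k) R := by
  have h : (R.tail k).vertices.Infinite := infinite_range_of_injective (R.tail k).injective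
  refine ⟨R.tail k, by rwa [inter_self], ?_⟩
  rwa [inter_eq_left.2]
  rintro _ ⟨n, rfl⟩
  exact ⟨n + k, rfl⟩

/-- Every topological end determines a graph end. -/
theorem TopEnd.exists_corresponds (γ : M.TopEnd) : ∃ ω : M.GraphEnd, γ.Corresponds ω := by
  induction γ using Quotient.inductionOn with
  | h U =>
    obtain ⟨r, l, hr, hE, hl⟩ := exists_injective_seq_of_descending
      (W := fun n => {v | M.vertex v ∈ U.toFun n}) (E := fun n => M.EdgeIn (U.toFun n))
      (fun m n hmn v hv => U.antitone hmn hv) U.exists_vertex_mem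
      (fun a => by
        by_contra! h
        have : M.vertex a ∈ ⋂ n, closure (U.toFun n) := mem_iInter.2 fun n => subset_closure (h n)
        rw [U.iInter_closure] at this
        exact this)
      (fun n a b h => h.vertex_mem)
      (fun n a ha b hb => M.reflTransGen_edgeIn (U.isOpen n) (U.isConnected n).isPreconnected ha hb)
    let R : M.Ray := ⟨r, hr, fun n => by
      obtain ⟨d, h1, h2, -⟩ := hE n
      rw [← h1, ← h2]
      exact d.adj⟩
    have hR : ∀ n, range (M.pt (R.dart n)) ⊆ U.toFun (l n) := by
      intro n
      obtain ⟨d, h1, h2, h⟩ := hE n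
      have : R.dart n = d := SimpleGraph.Dart.ext _ _ (Prod.ext h1.symm h2.symm)
      rwa [this]
    refine ⟨Quot.mk _ R, fun U' hU' n => ?_⟩
    -- Some `U j` lies in `U' n`, and a tail of the ray lies in `U j` because the levels of its
    -- edges tend to infinity.
    obtain ⟨j, -, hj, -⟩ := Quotient.exact hU' n
    obtain ⟨k, hk⟩ := eventually_atTop.1 (hl.eventually_ge_atTop j)
    refine ⟨R.tail k, Quot.sound (R.rayEquiv_tail k), iUnion_subset fun m => ?_⟩
    have h1 : (R.tail k).dart m = R.dart (m + k) :=
      SimpleGraph.Dart.ext _ _ (Prod.ext rfl (congrArg R.toFun (add_right_comm m 1 k)))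
    rw [h1]
    exact (hR _).trans ((U.antitone (hk _ (Nat.le_add_left _ _))).trans hj)

end EndSeq

/-! ### Components off finite sets, and ends at which infinite vertex sets accumulate -/

section Components

/-- The vertices joined to `u` by a path avoiding `K`. -/
def componentOff (K : Set V) (u : V) : Set V := {v | Relation.ReflTransGen (M.AdjIn Kᶜ) u v}

theorem reflTransGen_adjIn_symm {C : Set V} {v w : V}
    (h : Relation.ReflTransGen (M.AdjIn C) v w) : Relation.ReflTransGen (M.AdjIn C) w v := by
  have : Std.Symm (M.AdjIn C) := ⟨fun _ _ h => ⟨h.1.symm, h.2.2, h.2.1⟩⟩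
  exact symm h

theorem reflTransGen_componentOff {K : Set V} {u v w : V} (hv : v ∈ M.componentOff K u)
    (hw : w ∈ M.componentOff K u) :
    Relation.ReflTransGen (M.AdjIn (M.componentOff K u)) v w := by
  have h : ∀ v ∈ M.componentOff K u,
      Relation.ReflTransGen (M.AdjIn (M.componentOff K u)) u v := by
    intro v hv
    induction hv with
    | refl => exact Relation.ReflTransGen.refl
    | tail hb hbc ih => exact ih.tail ⟨hbc.1, hb, hb.tail hbc⟩
  exact (M.reflTransGen_adjIn_symm (h v hv)).trans (h w hw)

theorem componentOff_subset_compl {K : Set V} {u : V} (hu : u ∉ K) :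
    M.componentOff K u ⊆ Kᶜ := by
  intro v hv
  rcases Relation.ReflTransGen.cases_tail hv with rfl | ⟨_, -, h⟩
  · exact hu
  · exact h.2.2

theorem closedNeighbors_componentOff_subset {K : Set V} {u : V} (hu : u ∉ K) :
    M.closedNeighbors (M.componentOff K u) ⊆ M.componentOff K u ∪ K := by
  rintro v (hv | ⟨w, hw, hvw⟩)
  · exact Or.inl hv
  · by_cases hK : v ∈ K
    · exact Or.inr hK
    · exact Or.inl (Relation.ReflTransGen.tail hw
        ⟨hvw.symm, M.componentOff_subset_compl hu hw, hK⟩)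

/-- Cell ends of a point in the closure lie in the component or in `K`. One in the component would
put the point in the open star itself, so the frontier lies in the compact `spanned K`. -/
theorem isCompact_frontier_openStar_componentOff {K : Set V} (hK : K.Finite) {u : V}
    (hu : u ∉ K) : IsCompact (frontier (M.openStar (M.componentOff K u))) := by
  refine (M.isCompact_spanned hK).of_isClosed_subset isClosed_frontier fun x hx => ?_
  rw [(M.isOpen_openStar _).frontier_eq] at hx
  intro w hw
  rcases M.closedNeighbors_componentOff_subset hu (M.closure_openStar_subset _ hx.1 hw) with h | h
  · exact absurd (M.mem_openStar.2 ⟨w, h, hw⟩) hx.2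
  · exact h

/-- By connectedness every vertex off `K` lies in the component of some neighbour of `K`. Local
finiteness leaves finitely many such components, and the ultrafilter selects one of them. -/
theorem exists_componentOff_mem {K : Set V} (hK : K.Finite) (hne : K.Nonempty)
    {𝒰 : Ultrafilter V} (h𝒰 : (𝒰 : Filter V) ≤ cofinite) :
    ∃ u, u ∉ K ∧ M.componentOff K u ∈ 𝒰 := by
  obtain ⟨k, hk⟩ := hne
  set N : Set V := (⋃ a ∈ K, M.graph.neighborSet a) \ K
  have hN : N.Finite := (hK.biUnion fun a _ => M.locallyFinite a).sdiff
  have hcover : ∀ v, v ∈ K ∨ ∃ u ∈ N, v ∈ M.componentOff K u := by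
    intro v
    have h := (SimpleGraph.reachable_iff_reflTransGen k v).1 (M.connected.preconnected k v)
    induction h with
    | refl => exact Or.inl hk
    | @tail b c _ hbc ih =>
      by_cases hc : c ∈ K
      · exact Or.inl hc
      · right
        rcases ih with hb | ⟨u, hu, hb⟩
        · exact ⟨c, ⟨mem_biUnion hb hbc, hc⟩, Relation.ReflTransGen.refl⟩
        · exact ⟨u, hu, Relation.ReflTransGen.tail hb
            ⟨hbc, M.componentOff_subset_compl hu.2 hb, hc⟩⟩
  have hKc : Kᶜ ∈ 𝒰 := h𝒰 hK.compl_mem_cofinite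
  have hmem : (⋃ u ∈ N, M.componentOff K u) ∈ 𝒰 := by
    refine mem_of_superset hKc fun v hv => ?_
    obtain ⟨u, hu, h⟩ := (hcover v).resolve_left hv
    exact mem_biUnion hu h
  obtain ⟨u, hu, h⟩ := (Ultrafilter.finite_biUnion_mem_iff hN).1 hmem
  exact ⟨u, hu.2, h⟩

theorem componentOff_subset {K K' : Set V} (hK : K ⊆ K') {u u' : V}
    (h : (M.componentOff K u ∩ M.componentOff K' u').Nonempty) :
    M.componentOff K' u' ⊆ M.componentOff K u := by
  obtain ⟨w, hw, hw'⟩ := h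
  intro v hv
  have h1 : Relation.ReflTransGen (M.AdjIn K'ᶜ) w v :=
    (M.reflTransGen_adjIn_symm hw').trans hv
  refine Relation.ReflTransGen.trans hw (Relation.ReflTransGen.mono ?_ _ _ h1)
  exact fun a b hab => ⟨hab.1, fun h => hab.2.1 (hK h), fun h => hab.2.2 (hK h)⟩

/-- Every infinite set of vertices accumulates at a topological end, described by a decreasing
sequence of connected sets of vertices outside larger and larger finite sets. -/
theorem exists_endSeq_of_infinite [Countable V] {X : Set V} (hX : X.Infinite) :
    ∃ (U : M.EndSeq) (C : ℕ → Set V), (∀ n, U.toFun n = M.openStar (C n)) ∧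
      (∀ v, ∃ N, ∀ n ≥ N, v ∉ C n) ∧
      (∀ n, ∀ v ∈ C n, ∀ w ∈ C n, Relation.ReflTransGen (M.AdjIn (C n)) v w) ∧
      ∀ n, (C n ∩ X).Nonempty := by
  have : Nonempty V := ⟨hX.nonempty.some⟩
  obtain ⟨e, he⟩ := exists_surjective_nat V
  let K : ℕ → Set V := fun n => e '' Iic n
  have hKf : ∀ n, (K n).Finite := fun n => (finite_Iic n).image e
  have hKm : Monotone K := fun m n hmn => image_mono (Iic_subset_Iic.2 hmn)
  have hKe : ∀ v, ∀ᶠ n in atTop, v ∈ K n := by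
    intro v
    obtain ⟨m, rfl⟩ := he v
    filter_upwards [eventually_ge_atTop m] with n hn using ⟨m, hn, rfl⟩
  have hNe : (cofinite ⊓ 𝓟 X).NeBot := hX.cofinite_inf_principal_neBot
  -- A single ultrafilter selects the components for all `n`. Any two selected components meet, so
  -- they are nested, and each meets `X`.
  let 𝒰 : Ultrafilter V := Ultrafilter.of (cofinite ⊓ 𝓟 X)
  have h𝒰 : (𝒰 : Filter V) ≤ cofinite := (Ultrafilter.of_le _).trans inf_le_left
  have hX𝒰 : X ∈ 𝒰 := (Ultrafilter.of_le _).trans inf_le_right (mem_principal_self X)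
  choose u hu hu𝒰 using fun n =>
    M.exists_componentOff_mem (hKf n) ⟨e n, n, self_mem_Iic, rfl⟩ h𝒰
  let C : ℕ → Set V := fun n => M.componentOff (K n) (u n)
  have hCK : ∀ n, ∀ v ∈ C n, v ∉ K n := fun n v hv => M.componentOff_subset_compl (hu n) hv
  have hCr : ∀ n, ∀ v ∈ C n, ∀ w ∈ C n, Relation.ReflTransGen (M.AdjIn (C n)) v w :=
    fun n v hv w hw => M.reflTransGen_componentOff hv hw
  have hCs : ∀ n, C (n + 1) ⊆ C n := fun n =>
    M.componentOff_subset (hKm (Nat.le_succ n))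
      (Ultrafilter.nonempty_of_mem (inter_mem (hu𝒰 n) (hu𝒰 (n + 1))))
  refine ⟨{ toFun := fun n => M.openStar (C n)
            isOpen := fun n => M.isOpen_openStar _
            isConnected := fun n => ⟨⟨M.vertex (u n), M.vertex_mem_openStar.2
              Relation.ReflTransGen.refl⟩, M.isPreconnected_openStar (hCr n)⟩
            isCompact_frontier := fun n =>
              M.isCompact_frontier_openStar_componentOff (hKf n) (hu n)
            succ_subset := fun n x hx => hx.mono (inter_subset_inter_right _ (hCs n))
            iInter_closure := ?_ }, C, fun n => rfl, fun v => ?_, hCr,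
    fun n => Ultrafilter.nonempty_of_mem (inter_mem (hu𝒰 n) hX𝒰)⟩
  · refine eq_empty_of_forall_notMem fun x hx => ?_
    -- Once `K n` contains a cell end of `x` and all its neighbours, `x` is outside the closure of
    -- the star of `C n`.
    obtain ⟨v, hv⟩ := M.cellEnds_nonempty x
    have h1 : ∀ᶠ n in atTop, ∀ w ∈ M.graph.neighborSet v, w ∈ K n :=
      (M.locallyFinite v).eventually_all.2 fun w _ => hKe w
    obtain ⟨n, hn, hvn⟩ := (h1.and (hKe v)).exists
    rcases M.closure_openStar_subset _ (mem_iInter.1 hx n) hv with h | ⟨w, hw, hvw⟩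
    · exact hCK n v h hvn
    · exact hCK n w hw (hn w hvw)
  · obtain ⟨N, hN⟩ := eventually_atTop.1 (hKe v)
    exact ⟨N, fun n hn h => hCK n v h (hN n hn)⟩

end Components

/-! ### Energy bounds along rays and paths -/

section Energy

/-- The square of the `H¹` norm of `f` on the edge of the dart `d`. -/
def dartEnergy (f : M.Point → ℂ) (d : M.graph.Dart) : ℝ≥0∞ := edgeEnergy (M.len d) (M.onEdge f d)

theorem sqNorm_add_sqNormDeriv (f : M.Point → ℂ) :
    M.sqNorm f + M.sqNormDeriv f = 2⁻¹ * ∑' d, M.dartEnergy f d := by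
  unfold sqNorm sqNormDeriv dartEnergy edgeEnergy
  rw [← mul_add, ENNReal.tsum_add]
  rfl

theorem normH1_lt_iff {f : M.Point → ℂ} {ε : ℝ≥0∞} :
    M.normH1 f < ε ↔ 2⁻¹ * ∑' d, M.dartEnergy f d < ε ^ 2 := by
  rw [← sqNorm_add_sqNormDeriv, normH1, one_div, ENNReal.rpow_inv_lt_iff (by norm_num),
    ENNReal.rpow_ofNat]

theorem tsum_dartEnergy_lt_top {f : M.Point → ℂ} (hf : f ∈ M.H1) :
    ∑' d, M.dartEnergy f d < ∞ := by
  have h : 2⁻¹ * ∑' d, M.dartEnergy f d < ∞ := by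
    rw [← sqNorm_add_sqNormDeriv]
    exact ENNReal.add_lt_top.2 hf.2.2
  exact ENNReal.lt_top_of_mul_ne_top_right h.ne (by simp)

theorem onEdge_apply (f : M.Point → ℂ) {d : M.graph.Dart} {t : ℝ} (ht : t ∈ Icc 0 (M.len d)) :
    M.onEdge f d t = f (M.pt d ⟨t, ht⟩) := IccExtend_of_mem _ _ ht

theorem zero_mem_Icc_len (d : M.graph.Dart) : (0 : ℝ) ∈ Icc 0 (M.len d) :=
  left_mem_Icc.2 (M.len_pos d).le

theorem len_mem_Icc_len (d : M.graph.Dart) : M.len d ∈ Icc 0 (M.len d) :=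
  right_mem_Icc.2 (M.len_pos d).le

theorem onEdge_zero (f : M.Point → ℂ) (d : M.graph.Dart) :
    M.onEdge f d 0 = f (M.vertex d.fst) := by
  rw [M.onEdge_apply f (M.zero_mem_Icc_len d), ← M.pt_origin]
  rfl

theorem onEdge_len (f : M.Point → ℂ) (d : M.graph.Dart) :
    M.onEdge f d (M.len d) = f (M.vertex d.snd) := by
  rw [M.onEdge_apply f (M.len_mem_Icc_len d), ← M.pt_terminus]
  rfl

theorem onEdge_sub (f g : M.Point → ℂ) (d : M.graph.Dart) :
    M.onEdge (f - g) d = M.onEdge f d - M.onEdge g d := rfl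

theorem onEdge_symm (f : M.Point → ℂ) {d : M.graph.Dart} {t : ℝ} (ht : t ∈ Icc 0 (M.len d)) :
    M.onEdge f d.symm (M.len d - t) = M.onEdge f d t := by
  have h := (M.reverse d ⟨t, ht⟩).2
  have h' : M.len d - t ∈ Icc 0 (M.len d.symm) := h
  rw [M.onEdge_apply f ht, M.onEdge_apply f h']
  exact congrArg f (M.pt_reverse d ⟨t, ht⟩)

/-- Absolute continuity on each edge. -/
def EdgewiseAC (f : M.Point → ℂ) : Prop :=
  ∀ d, AbsolutelyContinuousOnInterval (M.onEdge f d) 0 (M.len d)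

variable {M} {f : M.Point → ℂ}

theorem EdgewiseAC.fst_le (hf : M.EdgewiseAC f) (d : M.graph.Dart) :
    ‖f (M.vertex d.fst)‖ₑ ^ 2 ≤ ‖f (M.vertex d.snd)‖ₑ ^ 2 + M.dartEnergy f d := by
  rw [← M.onEdge_zero f, ← M.onEdge_len f]
  exact (hf d).enorm_sq_le_add_edgeEnergy (M.len_pos d) (M.zero_mem_Icc_len d)
    (M.len_mem_Icc_len d)

theorem EdgewiseAC.snd_le (hf : M.EdgewiseAC f) (d : M.graph.Dart) :
    ‖f (M.vertex d.snd)‖ₑ ^ 2 ≤ ‖f (M.vertex d.fst)‖ₑ ^ 2 + M.dartEnergy f d := by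
  rw [← M.onEdge_zero f, ← M.onEdge_len f]
  exact (hf d).enorm_sq_le_add_edgeEnergy (M.len_pos d) (M.len_mem_Icc_len d)
    (M.zero_mem_Icc_len d)

theorem Ray.dart_injective (R : M.Ray) : Function.Injective R.dart := fun _ _ h =>
  R.injective (congrArg (fun d : M.graph.Dart => d.fst) h)

/-- The values along a ray are bounded by the `H¹` norm. -/
theorem EdgewiseAC.ray_le (hf : M.EdgewiseAC f) (R : M.Ray) (m : ℕ) :
    ENNReal.ofReal (M.len (R.dart 0)) * ‖f (M.vertex (R.toFun m))‖ₑ ^ 2 ≤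
      (1 + 2 * ENNReal.ofReal (M.len (R.dart 0))) * ∑' d, M.dartEnergy f d := by
  have h1 : ∀ m, ‖f (M.vertex (R.toFun m))‖ₑ ^ 2 ≤ ‖f (M.vertex (R.toFun 0))‖ₑ ^ 2 +
      ∑ n ∈ Finset.range m, M.dartEnergy f (R.dart n) := by
    intro m
    induction m with
    | zero => simp
    | succ m ih =>
      rw [Finset.sum_range_succ, ← add_assoc]
      exact (hf.snd_le (R.dart m)).trans (add_le_add ih le_rfl)
  have h2 : ∑ n ∈ Finset.range m, M.dartEnergy f (R.dart n) ≤ ∑' d, M.dartEnergy f d :=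
    (ENNReal.sum_le_tsum _).trans (ENNReal.tsum_comp_le_tsum_of_injective R.dart_injective _)
  -- The value at the start of the ray is controlled by averaging over the first edge; the later
  -- values follow by adding energies.
  have h3 : ENNReal.ofReal (M.len (R.dart 0)) * ‖f (M.vertex (R.toFun 0))‖ₑ ^ 2 ≤
      (1 + ENNReal.ofReal (M.len (R.dart 0))) * ∑' d, M.dartEnergy f d := by
    have h := ofReal_mul_enorm_sq_le_edgeEnergy (M.len_pos _) (hf (R.dart 0))
      (M.zero_mem_Icc_len (R.dart 0))
    rw [M.onEdge_zero] at h
    exact h.trans (mul_le_mul_right (ENNReal.le_tsum _) _)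
  calc _ ≤ ENNReal.ofReal (M.len (R.dart 0)) * (‖f (M.vertex (R.toFun 0))‖ₑ ^ 2 +
        ∑' d, M.dartEnergy f d) := mul_le_mul_right ((h1 m).trans (add_le_add le_rfl h2)) _
    _ ≤ (1 + ENNReal.ofReal (M.len (R.dart 0))) * ∑' d, M.dartEnergy f d +
        ENNReal.ofReal (M.len (R.dart 0)) * ∑' d, M.dartEnergy f d := by
      rw [mul_add]
      exact add_le_add h3 le_rfl
    _ = _ := by ring

variable (M) in
/-- The graph of the edges with both ends in `C`. -/
def graphIn (C : Set V) : SimpleGraph V where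
  Adj := M.AdjIn C
  symm := ⟨fun _ _ h => ⟨h.1.symm, h.2.2, h.2.1⟩⟩
  loopless := ⟨fun _ h => h.1.ne rfl⟩

/-- The darts of a path start at distinct vertices, so no energy is counted twice. Recording that
`d.fst` lies in the support makes the induction work: the first dart starts outside the support of
the rest. -/
theorem EdgewiseAC.le_of_isPath (hf : M.EdgewiseAC f) {C : Set V} {v w : V}
    (p : (M.graphIn C).Walk v w) (hp : p.IsPath) :
    ‖f (M.vertex v)‖ₑ ^ 2 ≤ ‖f (M.vertex w)‖ₑ ^ 2 +
      ∑' d, {d : M.graph.Dart | d.fst ∈ C ∧ d.fst ∈ p.support}.indicator (M.dartEnergy f) d := by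
  classical
  induction p with
  | nil => exact le_self_add
  | @cons a b c h p ih =>
    rw [SimpleGraph.Walk.cons_isPath_iff] at hp
    let d₀ : M.graph.Dart := ⟨(a, b), h.1⟩
    refine ((hf.fst_le d₀).trans (add_le_add (ih hp.1) le_rfl)).trans ?_
    rw [add_assoc]
    refine add_le_add le_rfl ?_
    rw [← tsum_ite_eq d₀ (fun _ => M.dartEnergy f d₀), ← ENNReal.tsum_add]
    refine ENNReal.tsum_le_tsum fun d => ?_
    by_cases hd : d = d₀
    · have h1 : d ∉ {d : M.graph.Dart | d.fst ∈ C ∧ d.fst ∈ p.support} := fun hc =>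
        hp.2 (by rw [hd] at hc; exact hc.2)
      have h2 : d ∈ {d : M.graph.Dart | d.fst ∈ C ∧
          d.fst ∈ (SimpleGraph.Walk.cons h p).support} := by
        rw [hd]
        exact ⟨h.2.1, by simp [d₀]⟩
      rw [indicator_of_notMem h1, indicator_of_mem h2, if_pos hd, zero_add, hd]
    · rw [if_neg hd, add_zero]
      refine indicator_le_indicator_of_subset ?_ (fun _ => zero_le) d
      exact fun d hd => ⟨hd.1, by simp [hd.2]⟩

theorem EdgewiseAC.le_of_reflTransGen (hf : M.EdgewiseAC f) {C : Set V} {v w : V}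
    (h : Relation.ReflTransGen (M.AdjIn C) v w) :
    ‖f (M.vertex v)‖ₑ ^ 2 ≤ ‖f (M.vertex w)‖ₑ ^ 2 +
      ∑' d, {d : M.graph.Dart | d.fst ∈ C}.indicator (M.dartEnergy f) d := by
  classical
  obtain ⟨p⟩ := (SimpleGraph.reachable_iff_reflTransGen (G := M.graphIn C) v w).2 h
  refine (hf.le_of_isPath p.toPath.1 p.toPath.2).trans (add_le_add le_rfl ?_)
  exact ENNReal.tsum_le_tsum fun d =>
    indicator_le_indicator_of_subset (fun d hd => hd.1) (fun _ => zero_le) d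

end Energy

/-! ### Decay along rays and at all but finitely many vertices -/

section EndValues

variable {M} {f : M.Point → ℂ}

theorem eventually_eq_zero_of_mem_kirchhoffDomain {g : M.Point → ℂ}
    (hg : g ∈ M.kirchhoffDomain) (R : M.Ray) :
    ∀ᶠ n in atTop, g (M.vertex (R.toFun n)) = 0 := by
  have h := R.dart_injective.tendsto_cofinite.eventually hg.2.2.2.compl_mem_cofinite
  rw [Nat.cofinite_eq_atTop] at h
  filter_upwards [h] with n hn
  by_contra hc
  exact hn ⟨M.origin _, by rwa [M.pt_origin]⟩

/-- Functions in `H¹₀` tend to zero along every ray. -/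
theorem tendsto_zero_of_mem_H1Zero (hf : f ∈ M.H1Zero) (R : M.Ray) :
    Tendsto (fun n => f (M.vertex (R.toFun n))) atTop (𝓝 0) := by
  rw [tendsto_zero_iff_enorm_tendsto_zero, ENNReal.tendsto_nhds_zero]
  intro η hη
  set L := M.len (R.dart 0) with hL
  have hLpos : 0 < L := M.len_pos _
  obtain ⟨ε, hε, hεη⟩ : ∃ ε : ℝ≥0∞, 0 < ε ∧
      (1 + 2 * ENNReal.ofReal L) * (2 * ε ^ 2) < ENNReal.ofReal L * η ^ 2 := by
    have hc : Continuous fun ε : ℝ≥0∞ => (1 + 2 * ENNReal.ofReal L) * (2 * ε ^ 2) :=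
      (ENNReal.continuous_const_mul (by finiteness)).comp
        ((ENNReal.continuous_const_mul (by simp)).comp (ENNReal.continuous_pow 2))
    have h0 := hc.tendsto 0
    have hpos : 0 < ENNReal.ofReal L * η ^ 2 :=
      ENNReal.mul_pos (by simpa using hLpos) (ENNReal.pow_pos hη 2).ne'
    simp only [ne_eq, OfNat.ofNat_ne_zero, not_false_eq_true, zero_pow, mul_zero] at h0
    have h1 := (h0.mono_left (nhdsWithin_le_nhds (s := Ioi 0))).eventually (gt_mem_nhds hpos)
    obtain ⟨ε, h2, h3⟩ := (h1.and self_mem_nhdsWithin).exists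
    exact ⟨ε, h3, h2⟩
  obtain ⟨g, hg, hgε⟩ := hf.2 ε hε
  rw [normH1_lt_iff] at hgε
  have hAC : M.EdgewiseAC (f - g) := fun d => (hf.1.2.1 d).1.sub (hg.2.1 d).1.1
  filter_upwards [eventually_eq_zero_of_mem_kirchhoffDomain hg R] with n hn
  have h1 := hAC.ray_le R n
  simp only [Pi.sub_apply, hn, sub_zero] at h1
  have h2 : ∑' d, M.dartEnergy (f - g) d ≤ 2 * ε ^ 2 := by
    have := mul_le_mul_right hgε.le 2
    rwa [← mul_assoc, ENNReal.mul_inv_cancel (by simp) (by simp), one_mul] at this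
  by_contra! hc
  have h3 : ENNReal.ofReal L * η ^ 2 ≤ ENNReal.ofReal L * ‖f (M.vertex (R.toFun n))‖ₑ ^ 2 :=
    mul_le_mul_right (pow_le_pow_left' hc.le 2) _
  exact absurd (h3.trans (h1.trans (mul_le_mul_right h2 _))) (not_le.2 hεη)

/-- A function in `H¹` vanishing at all ends is small at all but finitely many vertices. -/
theorem finite_lt_norm_of_hasEndValue_zero [Countable V] (hf : f ∈ M.H1)
    (hend : ∀ γ : M.TopEnd, M.HasEndValue f γ 0) {δ : ℝ} (hδ : 0 < δ) :
    {v | δ < ‖f (M.vertex v)‖}.Finite := by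
  by_contra hX
  obtain ⟨U, C, hUC, hCv, hCr, hCX⟩ := M.exists_endSeq_of_infinite hX
  obtain ⟨ω, hω, hlim⟩ := hend (Quotient.mk M.endSetoid U)
  have hpos : 0 < ENNReal.ofReal δ ^ 2 / 2 :=
    ENNReal.half_pos (ENNReal.pow_pos (ENNReal.ofReal_pos.2 hδ) 2).ne'
  obtain ⟨s, hs⟩ := ((tendsto_order.1 (ENNReal.tendsto_tsum_compl_atTop_zero
    (M.tsum_dartEnergy_lt_top hf).ne)).2 _ hpos).exists
  -- The finite set `s` carries all but `δ² / 2` of the energy. For large `n` no dart starting in `C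
  -- n` belongs to `s`, and the ray supplies a vertex where `‖f‖² < δ² / 2`.
  have hev : ∀ᶠ n in atTop, ∀ d ∈ s, d.fst ∉ C n := by
    rw [Finset.eventually_all]
    exact fun d _ => eventually_atTop.2 (hCv d.fst)
  obtain ⟨n, hn⟩ := hev.exists
  obtain ⟨R, hRω, hRU⟩ := hω U rfl n
  have hRC : ∀ m, R.toFun m ∈ C n := by
    intro m
    rw [← M.vertex_mem_openStar, ← hUC]
    refine hRU (mem_iUnion.2 ⟨m, M.origin _, M.pt_origin _⟩)
  have hl := (hlim R hRω).enorm
  rw [enorm_zero] at hl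
  have hl2 := ENNReal.Tendsto.pow (n := 2) hl
  rw [zero_pow two_ne_zero] at hl2
  obtain ⟨m, hm⟩ := ((tendsto_order.1 hl2).2 _ hpos).exists
  obtain ⟨x, hxC, hxX⟩ := hCX n
  have hAC : M.EdgewiseAC f := fun d => (hf.2.1 d).1
  have h1 := hAC.le_of_reflTransGen (hCr n x hxC _ (hRC m))
  have h2 : ∑' d, {d : M.graph.Dart | d.fst ∈ C n}.indicator (M.dartEnergy f) d ≤
      ∑' d : {d // d ∉ s}, M.dartEnergy f d := by
    refine le_trans ?_ (tsum_subtype {d | d ∉ s} (M.dartEnergy f)).ge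
    exact ENNReal.tsum_le_tsum fun d => indicator_le_indicator_of_subset
      (fun d hd hds => hn d hds hd) (fun _ => zero_le) d
  have h3 := (h1.trans (add_le_add le_rfl h2)).trans_lt (ENNReal.add_lt_add hm hs)
  rw [ENNReal.add_halves] at h3
  have h4 : ENNReal.ofReal δ ≤ ‖f (M.vertex x)‖ₑ := by
    rw [← ofReal_norm]
    exact ENNReal.ofReal_le_ofReal (le_of_lt hxX)
  exact absurd (pow_le_pow_left' h4 2) (not_le.2 h3)

end EndValues

/-! ### Gluing edge functions and density of the pre-minimal domain -/

section Density

/-- The function on the metric graph with given values at the vertices and on the edges. -/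
def glueEdges (a : V → ℂ) (G : M.graph.Dart → ℝ → ℂ) (h0 : ∀ d, G d 0 = a d.fst)
    (hs : ∀ d, ∀ t ∈ Icc 0 (M.len d), G d.symm (M.len d - t) = G d t) : M.Point → ℂ :=
  Quot.lift (Sum.elim a fun p => G p.1 p.2) (by
    rintro _ _ (d | ⟨d, t⟩)
    · exact h0 d
    · exact (hs d t t.2).symm)

variable {M}

theorem onEdge_glueEdges {a : V → ℂ} {G : M.graph.Dart → ℝ → ℂ} {h0 : ∀ d, G d 0 = a d.fst}
    {hs : ∀ d, ∀ t ∈ Icc 0 (M.len d), G d.symm (M.len d - t) = G d t} (d : M.graph.Dart) :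
    EqOn (M.onEdge (M.glueEdges a G h0 hs) d) (G d) (Icc 0 (M.len d)) := fun t ht => by
  rw [M.onEdge_apply _ ht]
  rfl

theorem glueEdges_mem_kirchhoffDomain {a : V → ℂ} {G : M.graph.Dart → ℝ → ℂ}
    {h0 : ∀ d, G d 0 = a d.fst}
    {hs : ∀ d, ∀ t ∈ Icc 0 (M.len d), G d.symm (M.len d - t) = G d t}
    (hG : ∀ d, ContDiff ℝ 2 (G d)) (hd : ∀ d, deriv (G d) 0 = 0)
    (hfin : {d | G d ≠ 0}.Finite) : M.glueEdges a G h0 hs ∈ M.kirchhoffDomain := by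
  refine ⟨?_, fun d => ?_, fun v => finsum_eq_zero_of_forall_eq_zero fun d => ?_, ?_⟩
  · rw [continuous_iff]
    exact fun d => (hG d).continuous.comp continuous_subtype_val
  · exact ((hG d).memSobolevTwo (M.len_pos d)).congr (M.len_pos d).le
      (onEdge_glueEdges d).symm
  · have h := M.zero_mem_Icc_len d.1
    rw [derivOnEdge, derivWithin_congr (onEdge_glueEdges d.1) (onEdge_glueEdges d.1 h),
      ((hG d.1).differentiable (by norm_num) 0).derivWithin
        (uniqueDiffOn_Icc (M.len_pos d.1) 0 h), hd]
  · refine hfin.subset ?_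
    rintro d ⟨t, ht⟩ hc
    exact ht (congrFun hc t)

theorem exists_orientation [Countable V] :
    ∃ Pos : M.graph.Dart → Prop, ∀ d, Pos d.symm ↔ ¬Pos d := by
  obtain ⟨e, he⟩ := exists_injective_nat V
  refine ⟨fun d => e d.fst < e d.snd, fun d => ?_⟩
  have : e d.fst ≠ e d.snd := fun h => d.adj.ne (he h)
  change e d.snd < e d.fst ↔ _
  omega

/-- Functions chosen on the edges with matching end values and vanishing derivatives at the end
points fit together, after choosing an orientation, to an element of the pre-minimal domain. -/
theorem exists_mem_kirchhoffDomain_of_edges [Countable V] {f : M.Point → ℂ} {a : V → ℂ}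
    {P : M.graph.Dart → ℝ → ℂ} {b : M.graph.Dart → ℝ≥0∞} (hP : ∀ d, ContDiff ℝ 2 (P d))
    (hP0 : ∀ d, P d 0 = a d.fst) (hPL : ∀ d, P d (M.len d) = a d.snd)
    (hd0 : ∀ d, deriv (P d) 0 = 0) (hdL : ∀ d, deriv (P d) (M.len d) = 0)
    (hb : ∀ d, edgeEnergy (M.len d) (M.onEdge f d - P d) ≤ b d) (hfin : {d | P d ≠ 0}.Finite) :
    ∃ g ∈ M.kirchhoffDomain, 2⁻¹ * ∑' d, M.dartEnergy (f - g) d ≤ ∑' d, b d := by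
  classical
  obtain ⟨Pos, hPos⟩ := exists_orientation (M := M)
  -- The functions for a dart and its reverse are unrelated, so only that of the positive dart is
  -- kept and then reversed.
  let G : M.graph.Dart → ℝ → ℂ := fun d =>
    if Pos d then P d else fun t => P d.symm (M.len d - t)
  have hGp : ∀ d, Pos d → G d = P d := fun d h => if_pos h
  have hGn : ∀ d, ¬Pos d → G d = fun t => P d.symm (M.len d - t) := fun d h => if_neg h
  have h0 : ∀ d, G d 0 = a d.fst := by
    intro d
    by_cases h : Pos d
    · rw [hGp d h, hP0]
    · rw [hGn d h]
      have := hPL d.symm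
      rw [M.len_symm] at this
      simpa using this
  have hs : ∀ d, ∀ t ∈ Icc 0 (M.len d), G d.symm (M.len d - t) = G d t := by
    intro d t _
    by_cases h : Pos d
    · rw [hGp d h, hGn d.symm (by rw [hPos]; exact not_not.2 h)]
      simp [M.len_symm]
    · rw [hGn d h, hGp d.symm ((hPos d).2 h)]
  have hGc : ∀ d, ContDiff ℝ 2 (G d) := by
    intro d
    by_cases h : Pos d
    · rw [hGp d h]; exact hP d
    · rw [hGn d h]; exact (hP d.symm).comp (contDiff_const.sub contDiff_id)
  have hGd : ∀ d, deriv (G d) 0 = 0 := by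
    intro d
    by_cases h : Pos d
    · rw [hGp d h]; exact hd0 d
    · rw [hGn d h, deriv_comp_const_sub, sub_zero, ← M.len_symm, hdL, neg_zero]
  have hGf : {d | G d ≠ 0}.Finite := by
    have hinj : Function.Injective (fun d : M.graph.Dart => d.symm) :=
      SimpleGraph.Dart.symm_involutive.injective
    refine (hfin.union (hfin.preimage hinj.injOn)).subset fun d hd => ?_
    by_cases h : Pos d
    · left
      have hd' : G d ≠ 0 := hd
      rwa [hGp d h] at hd'
    · right
      intro hc
      refine hd ?_
      rw [hGn d h]
      funext t
      have hc' : P d.symm = 0 := hc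
      simp [hc']
  refine ⟨M.glueEdges a G h0 hs, glueEdges_mem_kirchhoffDomain hGc hGd hGf, ?_⟩
  -- The bound is symmetric because either of the two functions may have been kept. Its sum is twice
  -- that of `b`, which cancels the factor `1/2`.
  have hE : ∀ d, M.dartEnergy (f - M.glueEdges a G h0 hs) d ≤ b d + b d.symm := by
    intro d
    rw [dartEnergy, onEdge_sub]
    by_cases h : Pos d
    · have : EqOn (M.onEdge f d - M.onEdge (M.glueEdges a G h0 hs) d) (M.onEdge f d - P d)
          (Icc 0 (M.len d)) := fun t ht => by
        simp only [Pi.sub_apply]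
        rw [onEdge_glueEdges d ht, hGp d h]
      rw [edgeEnergy_congr this]
      exact (hb d).trans le_self_add
    · have : EqOn (M.onEdge f d - M.onEdge (M.glueEdges a G h0 hs) d)
          (fun t => (M.onEdge f d.symm - P d.symm) (M.len d - t)) (Icc 0 (M.len d)) :=
        fun t ht => by
          simp only [Pi.sub_apply]
          rw [onEdge_glueEdges d ht, hGn d h, M.onEdge_symm f ht]
      rw [edgeEnergy_congr this, edgeEnergy_reverse, ← M.len_symm]
      exact (hb d.symm).trans le_add_self
  have hsum : ∑' d : M.graph.Dart, b d.symm = ∑' d, b d :=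
    (Equiv.tsum_eq (SimpleGraph.Dart.symm_involutive.toPerm) b)
  calc 2⁻¹ * ∑' d, M.dartEnergy (f - M.glueEdges a G h0 hs) d
      ≤ 2⁻¹ * ∑' d, (b d + b d.symm) := mul_le_mul_right (ENNReal.tsum_le_tsum hE) _
    _ = 2⁻¹ * (2 * ∑' d, b d) := by rw [ENNReal.tsum_add, hsum, two_mul]
    _ = ∑' d, b d := by
      rw [← mul_assoc, ENNReal.inv_mul_cancel (by simp) (by simp), one_mul]

/-- A function in `H¹` that is small at all but finitely many vertices belongs to `H¹₀`. -/
theorem mem_H1Zero_of_finite_lt_norm [Countable V] {f : M.Point → ℂ} (hf : f ∈ M.H1)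
    (hsmall : ∀ δ : ℝ, 0 < δ → {v | δ < ‖f (M.vertex v)‖}.Finite) : f ∈ M.H1Zero := by
  classical
  refine ⟨hf, fun ε hε => ?_⟩
  have hκ : 0 < ε ^ 2 / 2 := ENNReal.half_pos (ENNReal.pow_pos hε 2).ne'
  have hDc : Countable M.graph.Dart :=
    Function.Injective.countable (f := fun d : M.graph.Dart => d.toProd)
      fun a b hab => SimpleGraph.Dart.ext _ _ hab
  obtain ⟨η, hη, hηs⟩ := ENNReal.exists_pos_sum_of_countable hκ.ne' M.graph.Dart
  obtain ⟨s, hs⟩ := ((tendsto_order.1 (ENNReal.tendsto_tsum_compl_atTop_zero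
    (M.tsum_dartEnergy_lt_top hf).ne)).2 (ε ^ 2 / 2 / 8)
      (ENNReal.div_pos hκ.ne' (by simp))).exists
  have hη' : ∀ d, (0 : ℝ≥0∞) < η d := fun d => ENNReal.coe_pos.2 (hη d)
  choose D hD hDp using fun d =>
    (hf.2.1 d).exists_contDiff_edgeEnergy_sub_le (M.len_pos d) (hη' d)
  -- Thresholding moves a value by at most `2 * δ` (at most `δ` in each of the real and imaginary
  -- parts), so on the edges of `s` the new end values stay within the tolerance `D d`.
  obtain ⟨δ, hδD, hδ⟩ : ∃ δ : ℝ, (∀ d ∈ s, 2 * δ ≤ D d) ∧ 0 < δ := by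
    have h : ∀ᶠ δ in 𝓝[>] (0 : ℝ), ∀ d ∈ s, 2 * δ ≤ D d := by
      rw [Finset.eventually_all]
      intro d _
      have hc : Tendsto (fun δ : ℝ => 2 * δ) (𝓝[>] 0) (𝓝 (2 * 0)) :=
        ((continuous_const_mul 2).tendsto 0).mono_left nhdsWithin_le_nhds
      rw [mul_zero] at hc
      exact hc.eventually (ge_mem_nhds (hD d))
    exact (h.and self_mem_nhdsWithin).exists
  let a : V → ℂ := fun v => softThreshold δ (f (M.vertex v))
  have haf : {v | a v ≠ 0}.Finite := (hsmall δ hδ).subset fun v hv => by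
    by_contra hc
    exact hv (softThreshold_eq_zero hδ.le (not_lt.1 hc))
  -- On `s` the function `f` itself is approximated. Off `s` it is replaced by zero, or by an
  -- approximation of its thresholding; there two applications of the sum inequality give `2 * (2 +
  -- 2) = 8` times the energy.
  let b : M.graph.Dart → ℝ≥0∞ := fun d => η d + 8 * {d | d ∉ s}.indicator (M.dartEnergy f) d
  have hP : ∀ d, ∃ p : ℝ → ℂ, ContDiff ℝ 2 p ∧ p 0 = a d.fst ∧ p (M.len d) = a d.snd ∧
      deriv p 0 = 0 ∧ deriv p (M.len d) = 0 ∧ edgeEnergy (M.len d) (M.onEdge f d - p) ≤ b d ∧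
      (d ∉ s → a d.fst = 0 → a d.snd = 0 → p = 0) := by
    intro d
    have hdL := M.len_pos d
    by_cases hds : d ∈ s
    · obtain ⟨p, h1, h2, h3, h4, h5, h6⟩ := hDp d (a d.fst) (a d.snd)
        (by rw [M.onEdge_zero]; exact (norm_softThreshold_sub_le hδ.le _).trans (hδD d hds))
        (by rw [M.onEdge_len]; exact (norm_softThreshold_sub_le hδ.le _).trans (hδD d hds))
      exact ⟨p, h1, h2, h3, h4, h5, h6.trans le_self_add, fun h => absurd hds h⟩
    have hbd : b d = η d + 8 * M.dartEnergy f d := by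
      simp only [b]
      rw [indicator_of_mem (s := {d | d ∉ s}) hds]
    by_cases ha : a d.fst = 0 ∧ a d.snd = 0
    · refine ⟨0, contDiff_const, by simp [ha.1], by simp [ha.2], by simp, by simp, ?_,
        fun _ _ _ => rfl⟩
      rw [sub_zero, hbd]
      calc M.dartEnergy f d = 1 * M.dartEnergy f d := (one_mul _).symm
        _ ≤ 8 * M.dartEnergy f d := mul_le_mul_left (by norm_num) _
        _ ≤ _ := le_add_self
    · have hAC := (hf.2.1 d).1
      have hS := (hf.2.1 d).softThreshold_comp hdL hδ.le
      obtain ⟨δ', hδ', H⟩ := hS.exists_contDiff_edgeEnergy_sub_le hdL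
        (ENNReal.half_pos (hη' d).ne')
      obtain ⟨p, h1, h2, h3, h4, h5, h6⟩ := H (a d.fst) (a d.snd)
        (by simp [a, M.onEdge_zero, hδ'.le]) (by simp [a, M.onEdge_len, hδ'.le])
      refine ⟨p, h1, h2, h3, h4, h5, ?_, fun _ h h' => absurd ⟨h, h'⟩ ha⟩
      have hpAC := (ContDiff.memSobolevOne hdL (h1.of_le (by norm_num))).1
      have e1 : M.onEdge f d - p = (M.onEdge f d - softThreshold δ ∘ M.onEdge f d) +
          (softThreshold δ ∘ M.onEdge f d - p) := by abel
      have e2 := edgeEnergy_sub_le hdL hAC hS.1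
      have e3 := edgeEnergy_add_le hdL (hAC.sub hS.1) (hS.1.sub hpAC)
      have e4 := edgeEnergy_softThreshold_comp_le hdL hδ.le hAC
      rw [e1, hbd]
      calc _ ≤ _ := e3
        _ ≤ 2 * (2 * M.dartEnergy f d + 2 * M.dartEnergy f d) + 2 * (η d / 2) := by
          gcongr
          exact e2.trans (add_le_add le_rfl (mul_le_mul_right e4 2))
        _ = η d + 8 * M.dartEnergy f d := by
          rw [ENNReal.mul_div_cancel (by simp) (by simp)]
          ring
  choose P hP2 hP0 hPL hd0 hdL hPb hPz using hP
  have hfin : {d | P d ≠ 0}.Finite := by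
    have h1 := M.finite_darts_fst haf
    have hinj : Function.Injective (fun d : M.graph.Dart => d.symm) :=
      SimpleGraph.Dart.symm_involutive.injective
    refine ((s.finite_toSet.union h1).union (h1.preimage hinj.injOn)).subset fun d hd => ?_
    by_contra hc
    simp only [mem_union, Finset.mem_coe, not_or] at hc
    exact hd (hPz d hc.1.1 (not_not.1 hc.1.2) (not_not.1 hc.2))
  obtain ⟨g, hg, hgb⟩ := exists_mem_kirchhoffDomain_of_edges hP2 hP0 hPL hd0 hdL hPb hfin
  refine ⟨g, hg, M.normH1_lt_iff.2 (hgb.trans_lt ?_)⟩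
  have h8 : 8 * ∑' d : {d // d ∉ s}, M.dartEnergy f d < ε ^ 2 / 2 := by
    rw [mul_comm]
    exact ENNReal.mul_lt_of_lt_div hs
  have h9 : ∑' d, b d = ∑' d, (η d : ℝ≥0∞) + 8 * ∑' d : {d // d ∉ s}, M.dartEnergy f d := by
    simp only [b]
    rw [ENNReal.tsum_add, ENNReal.tsum_mul_left]
    congr 2
    exact (tsum_subtype {d | d ∉ s} (M.dartEnergy f)).symm
  rw [h9]
  exact (ENNReal.add_lt_add hηs h8).trans_eq (ENNReal.add_halves _)

end Density

end MetricGraph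
end

theorem theorem3p9 {V : Type*} [Countable V] [Infinite V] (M : MetricGraph V) :
    M.H1Zero = {f : M.Point → ℂ | f ∈ M.H1 ∧ ∀ γ : M.TopEnd, M.HasEndValue f γ 0} := by
  ext f
  constructor
  · intro hf
    refine ⟨hf.1, fun γ => ?_⟩
    obtain ⟨ω, hω⟩ := MetricGraph.TopEnd.exists_corresponds M γ
    exact ⟨ω, hω, fun R _ => MetricGraph.tendsto_zero_of_mem_H1Zero hf R⟩
  · rintro ⟨hf, hend⟩
    exact MetricGraph.mem_H1Zero_of_finite_lt_norm hf fun δ hδ =>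
      MetricGraph.finite_lt_norm_of_hasEndValue_zero hf hend hδ
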